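/- Let $\mathbb N=\{1,2,3,\dots\}$ and $\mathbb T=[0,1]$, and for a bounded measurable $w>0$ on $(0,1)$ let $L^2(\mathbb T,w)$ be the space of measurable $f:(0,1)\to\mathbb C$ with $\int_0^1|f(t)|^2\,w(t)\,dt<\infty$ (modulo equality almost everywhere). Let $\Gamma\subset\mathbb N$ satisfy $\sum_{\gamma\in\Gamma}\frac1{\sqrt\gamma}<\infty$. Then, for every $w$ that is positive, increasing (not necessarily strictly) and bounded on $(0,1)$ and satisfies $\int_0^1\log w(t)\,dt=-\infty$, the exponentials $\{e^{2\pi i n t}: n\in\mathbb N\setminus\Gamma\}$ span $L^2(\mathbb T,w)$, that is, their finite linear combinations are dense in $L^2(\mathbb T,w)$. In particular, for every such $w$ the exponentials $\{e^{2\pi i n t}: n\in\mathbb N\setminus\{k^3:k\in\mathbb N\}\}$ span $L^2(\mathbb T,w)$. -/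

import Mathlib

open MeasureTheory Set
open scoped ENNReal

noncomputable section

/-- The integral of `log w` over `(0,1)` equals `-∞`: the positive part of `log w` has a finite
integral, and the negative part has an infinite one. -/
def LogIntegralEqNegInfty (w : ℝ → ℝ) : Prop :=
  (∫⁻ t in Ioo (0 : ℝ) 1, ENNReal.ofReal (Real.log (w t))) < ∞ ∧
    (∫⁻ t in Ioo (0 : ℝ) 1, ENNReal.ofReal (-Real.log (w t))) = ∞

/-- The weights with a deep right-hand zero at the origin: `w` is positive, increasing (in the wide
sense) and bounded on `(0,1)`, and the integral of `log w` over `(0,1)` is `-∞`. Values of `w`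
outside `(0,1)` play no role. -/
structure IsDeepZeroWeight (w : ℝ → ℝ) : Prop where
  pos : ∀ t ∈ Ioo (0 : ℝ) 1, 0 < w t
  mono : MonotoneOn w (Ioo (0 : ℝ) 1)
  bdd : ∃ M : ℝ, ∀ t ∈ Ioo (0 : ℝ) 1, w t ≤ M
  log_int : LogIntegralEqNegInfty w

/-- The measure `w(t) dt` on the circle, the circle being `[0,1]` with its Lebesgue measure
(the end points are a null set), so that `L²(𝕋, w)` is `Lp ℂ 2 (weightMeasure w)`. -/
def weightMeasure (w : ℝ → ℝ) : Measure ℝ :=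
  (volume.restrict (Ioo (0 : ℝ) 1)).withDensity (fun t => ENNReal.ofReal (w t))

/-- The exponential `t ↦ e^{2πint}`. -/
def expo (n : ℕ) (t : ℝ) : ℂ := Complex.exp (2 * Real.pi * Complex.I * n * t)

/-- The family of exponentials with frequencies in `S`, as a set of elements of `L²(𝕋, w)`. -/
def expSystem (w : ℝ → ℝ) (S : Set ℕ) : Set (Lp ℂ 2 (weightMeasure w)) :=
  {f | ∃ n ∈ S, f =ᵐ[weightMeasure w] expo n}

/-- The exponentials with frequencies in `S` span `L²(𝕋, w)`: the closed linear span of the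
family is the whole space. -/
def ExpSystemSpans (w : ℝ → ℝ) (S : Set ℕ) : Prop :=
  (Submodule.span ℂ (expSystem w S)).topologicalClosure = ⊤

/-- For the weights considered, every exponential does belong to `L²(𝕋, w)`, so that no frequency
is lost in `expSystem`. -/
theorem IsDeepZeroWeight.memLp_expo {w : ℝ → ℝ} (hw : IsDeepZeroWeight w) (n : ℕ) :
    MemLp (expo n) 2 (weightMeasure w) := by
  obtain ⟨M, hM⟩ := hw.bdd
  have hfin : IsFiniteMeasure (weightMeasure w) := by
    refine isFiniteMeasure_withDensity (ne_of_lt ?_)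
    calc (∫⁻ t in Ioo (0 : ℝ) 1, ENNReal.ofReal (w t))
        ≤ ∫⁻ _ in Ioo (0 : ℝ) 1, ENNReal.ofReal M :=
          setLIntegral_mono measurable_const
            (fun t ht => ENNReal.ofReal_le_ofReal (hM t ht))
      _ < ∞ := by simp
  have hc : Continuous (expo n) := by unfold expo; fun_prop
  refine MemLp.of_bound hc.aestronglyMeasurable 1 (Filter.Eventually.of_forall fun t => ?_)
  have h : (2 * Real.pi * Complex.I * n * t : ℂ) = ((2 * Real.pi * n * t : ℝ) : ℂ) * Complex.I := by
    push_cast; ring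
  rw [expo, h, Complex.norm_exp_ofReal_mul_I]

end

/-!
By duality, a function orthogonal to the exponentials gives a `g` whose frequencies in `ℕ ∖ Γ`
vanish and whose integral over `(0, s)` is `O(√w(s))`. For a finite `S ⊆ Γ` the product `P(x) =
∏_{γ ∈ S} (1 + x / γ)` acts as a Fourier multiplier: its kernel `∑_{n ≥ 0} P(n) ζⁿ` is a
polynomial in `(1 - ζ)⁻¹`, equal to `-∑_{n ≥ 1} P(-n) ζ⁻ⁿ` when `|ζ| > 1`. So the integral `F(z)`
of `g` against the kernel at `ζ = z e^{-2πit}` satisfies `F(0) = ∫ g`, and it is small outside the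
closed disc once `S` is most of `Γ`, because `P(-n) = 0` for `n ∈ S`.

Near the circle the kernel is controlled only at distances exceeding the exponential type of `P`
at the scale `ρ = |1 - z|`. As `∑ 1 / √γ < ∞`, an analytic self-map of the disc fixing `0` moves
the points inwards by that much, and the logarithm of the resulting bound is integrable on the
circle uniformly in `S`. At a point `e^{2πit}` with `t > 0` small, the mass of `g` on `(0, 2t)` is
small and so is `F` outside the disc, and a two-constants estimate gains a power of `w(2t)`.
Jensen's inequality then bounds `log |∫ g|` by `C + c ∫ log w = -∞`, so `∫ g = 0`. Multiplying `g`
by exponentials translates `Γ`, and conjugation reaches the remaining frequencies, so every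
Fourier coefficient of `g` vanishes.
-/

open Polynomial
open Real (posLog)
open scoped ComplexConjugate

/-! ### Multipliers and their kernels -/

theorem multichoose_succ_mul {R : Type*} [CommRing R] [BinomialRing R] (x : R) (k : ℕ) :
    Ring.multichoose x (k + 1) * (k + 1) = Ring.multichoose x k * (x + k) := by
  have hk := Ring.factorial_nsmul_multichoose_eq_ascPochhammer x k
  have hk1 := Ring.factorial_nsmul_multichoose_eq_ascPochhammer x (k + 1)
  rw [ascPochhammer_smeval_eq_eval] at hk hk1
  have := BinomialRing.toIsAddTorsionFree (R := R)
  refine nsmul_right_injective k.factorial_ne_zero ?_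
  rw [ascPochhammer_succ_eval, ← hk, Nat.factorial_succ] at hk1
  simp only [nsmul_eq_mul] at hk1 ⊢
  push_cast at hk1
  linear_combination hk1

theorem multichoose_neg_natCast (n k : ℕ) :
    Ring.multichoose (-n : ℂ) k = (-1) ^ k * n.choose k := by
  have h := Ring.choose_neg' (-n : ℂ) k
  rw [neg_neg, Ring.choose_natCast, Units.smul_def, Int.coe_negOnePow_natCast, zsmul_eq_mul] at h
  rw [h]
  push_cast
  rw [← mul_assoc, ← mul_pow, neg_one_mul, neg_neg, one_pow, one_mul]

theorem multichoose_add_one_nonneg {x : ℝ} (hx : 0 ≤ x) (k : ℕ) :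
    0 ≤ Ring.multichoose (x + 1) k := by
  refine le_of_smul_le_smul_left (a := k.factorial) ?_ k.factorial_pos
  rw [smul_zero, Ring.factorial_nsmul_multichoose_eq_ascPochhammer, ascPochhammer_smeval_eq_eval]
  exact (ascPochhammer_pos k _ (by linarith)).le

theorem pow_le_multichoose_add_one {k : ℕ} {x c : ℝ} (hc : 0 ≤ c) (h : k * c ≤ x) :
    c ^ k ≤ Ring.multichoose (x + 1) k := by
  have hx : 0 ≤ x := by nlinarith [(Nat.cast_nonneg k : (0 : ℝ) ≤ k)]
  suffices ∀ j ≤ k, c ^ j ≤ Ring.multichoose (x + 1) j from this k le_rfl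
  intro j hj
  induction j with
  | zero => simp
  | succ j ih =>
    have hjk : (j + 1 : ℝ) ≤ k := by exact_mod_cast hj
    refine le_of_mul_le_mul_right ?_ (by positivity : (0 : ℝ) < j + 1)
    calc c ^ (j + 1) * (j + 1) = c ^ j * ((j + 1) * c) := by ring
      _ ≤ Ring.multichoose (x + 1) j * (x + 1 + j) := by
        gcongr
        · exact multichoose_add_one_nonneg hx j
        · exact ih (by omega)
        · linarith [mul_le_mul_of_nonneg_right hjk hc, (Nat.cast_nonneg j : (0 : ℝ) ≤ j)]
      _ = Ring.multichoose (x + 1) (j + 1) * (j + 1) := (multichoose_succ_mul _ j).symm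

/-- The multiplier `x ↦ ∑ₖ qₖ (x + 1) ⋯ (x + k) / k!` attached to a polynomial `Q = ∑ₖ qₖ Xᵏ`. It is
encoded by `Q` because the sign of the `qₖ` matters, and because the kernel of the multiplier is a
simple function of `Q`; see `multKernel`. -/
noncomputable def multiplier (Q : ℝ[X]) (x : ℂ) : ℂ :=
  Q.sum fun k c => c * Ring.multichoose (x + 1) k

/-- The kernel `(1 - ζ)⁻¹ Q((1 - ζ)⁻¹)` of the multiplier of `Q`: the analytic continuation of
`∑ₙ P(n) ζⁿ`, where `P = multiplier Q`. -/
noncomputable def multKernel (Q : ℝ[X]) (ζ : ℂ) : ℂ := aeval (1 - ζ)⁻¹ (X * Q)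

theorem multiplier_add (Q R : ℝ[X]) (x : ℂ) :
    multiplier (Q + R) x = multiplier Q x + multiplier R x :=
  sum_add_index _ _ _ (by simp) fun _ _ _ => by push_cast; ring

theorem multiplier_monomial (k : ℕ) (c : ℝ) (x : ℂ) :
    multiplier (monomial k c) x = c * Ring.multichoose (x + 1) k :=
  sum_monomial_index _ _ (by simp)

theorem multiplier_C_mul (c : ℝ) (Q : ℝ[X]) (x : ℂ) :
    multiplier (C c * Q) x = c * multiplier Q x := by
  induction Q using Polynomial.induction_on' with
  | add Q R hQ hR => rw [mul_add, multiplier_add, hQ, hR, multiplier_add, mul_add]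
  | monomial k a => rw [C_mul_monomial, multiplier_monomial, multiplier_monomial]; push_cast; ring

theorem multiplier_X_sub_one_mul_derivative (Q : ℝ[X]) (x : ℂ) :
    multiplier ((X - 1) * derivative (X * Q)) x = x * multiplier Q x := by
  induction Q using Polynomial.induction_on' with
  | add Q R hQ hR => rw [mul_add, derivative_add, mul_add, multiplier_add, hQ, hR,
      multiplier_add, mul_add]
  | monomial k a =>
    have h : (X - 1) * derivative (X * monomial k a) =
        monomial (k + 1) (a * (k + 1)) + monomial k (-(a * (k + 1))) := by
      rw [X_mul_monomial, derivative_monomial, Nat.add_sub_cancel, sub_mul, X_mul_monomial, one_mul,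
        monomial_neg, ← sub_eq_add_neg]
      push_cast
      rfl
    rw [h, multiplier_add, multiplier_monomial, multiplier_monomial, multiplier_monomial]
    push_cast
    linear_combination a * multichoose_succ_mul (x + 1) k

theorem coeff_X_sub_one_mul_derivative (Q : ℝ[X]) (k : ℕ) :
    ((X - 1) * derivative (X * Q)).coeff k = k * (X * Q).coeff k - (k + 1) * Q.coeff k := by
  rw [sub_mul, one_mul, coeff_sub, coeff_derivative, coeff_X_mul]
  cases k with
  | zero => simp
  | succ k => rw [coeff_X_mul, coeff_derivative]; push_cast; ring

theorem card_lt_of_forall_one_le_of_forall_lt {s : Finset ℕ} {a : ℕ} (ha : 1 ≤ a)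
    (hs : ∀ γ ∈ s, 1 ≤ γ) (hsa : ∀ γ ∈ s, γ < a) : s.card < a := by
  have h := Finset.card_le_card fun γ hγ => Finset.mem_Ico.2 ⟨hs γ hγ, hsa γ hγ⟩
  rw [Nat.card_Ico] at h
  omega

/-- The `i`-th smallest `γ` is at least `i`, so its factor meets a `Q` of degree `< i ≤ γ` and the
coefficients stay nonnegative. -/
theorem exists_multiplier_eq_prod (S : Finset ℕ) (hS : ∀ γ ∈ S, 1 ≤ γ) :
    ∃ Q : ℝ[X], (∀ k, 0 ≤ Q.coeff k) ∧ ∀ x, multiplier Q x = ∏ γ ∈ S, (1 + x / γ) := by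
  suffices ∃ Q : ℝ[X], Q.natDegree ≤ S.card ∧ (∀ k, 0 ≤ Q.coeff k) ∧
      ∀ x, multiplier Q x = ∏ γ ∈ S, (1 + x / γ) by
    obtain ⟨Q, -, hQ⟩ := this
    exact ⟨Q, hQ⟩
  induction S using Finset.induction_on_max with
  | empty => exact ⟨1, by simp, fun k => by rw [coeff_one]; split_ifs <;> norm_num,
      fun x => by simpa using multiplier_monomial 0 1 x⟩
  | insert a s has ih =>
    obtain ⟨Q, hdeg, hnn, hQ⟩ := ih fun γ hγ => hS γ (Finset.mem_insert_of_mem hγ)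
    have hnotMem : a ∉ s := fun h => lt_irrefl _ (has a h)
    have hcard : s.card < a := card_lt_of_forall_one_le_of_forall_lt
      (hS a (Finset.mem_insert_self _ _)) (fun γ hγ => hS γ (Finset.mem_insert_of_mem hγ)) has
    have ha : (0 : ℝ) < a := by exact_mod_cast (Nat.zero_le _).trans_lt hcard
    refine ⟨Q + C (a : ℝ)⁻¹ * ((X - 1) * derivative (X * Q)), ?_, fun k => ?_, fun x => ?_⟩
    · rw [Finset.card_insert_of_notMem hnotMem, natDegree_le_iff_coeff_eq_zero]
      intro k hk
      obtain ⟨j, rfl⟩ : ∃ j, k = j + 1 := ⟨k - 1, by omega⟩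
      rw [coeff_add, coeff_C_mul, coeff_X_sub_one_mul_derivative, coeff_X_mul,
        coeff_eq_zero_of_natDegree_lt (by omega : Q.natDegree < j + 1),
        coeff_eq_zero_of_natDegree_lt (by omega : Q.natDegree < j)]
      simp
    · have hX : 0 ≤ (X * Q).coeff k := by cases k <;> simp [hnn]
      have hrest : 0 ≤ (1 - (a : ℝ)⁻¹ * (k + 1)) * Q.coeff k := by
        rcases le_or_gt k Q.natDegree with hk | hk
        · have hka : (k + 1 : ℝ) ≤ a := by exact_mod_cast (by omega : k + 1 ≤ a)
          exact mul_nonneg (sub_nonneg.2 ((inv_mul_le_one₀ ha).2 hka)) (hnn k)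
        · rw [coeff_eq_zero_of_natDegree_lt hk, mul_zero]
      rw [coeff_add, coeff_C_mul, coeff_X_sub_one_mul_derivative]
      have : 0 ≤ (a : ℝ)⁻¹ * (k * (X * Q).coeff k) := by positivity
      linarith
    · rw [multiplier_add, multiplier_C_mul, multiplier_X_sub_one_mul_derivative, hQ,
        Finset.prod_insert hnotMem]
      push_cast
      ring

theorem multKernel_zero_right (Q : ℝ[X]) : multKernel Q 0 = multiplier Q 0 := by
  rw [multKernel, map_mul]
  simp [multiplier, aeval_def, eval₂_eq_sum]

theorem hasSum_multiplier_neg (Q : ℝ[X]) {ζ : ℂ} (hζ : 1 < ‖ζ‖) :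
    HasSum (fun n : ℕ => multiplier Q (-((n : ℂ) + 1)) * ζ⁻¹ ^ (n + 1)) (-multKernel Q ζ) := by
  induction Q using Polynomial.induction_on' with
  | add Q R hQ hR =>
    simpa only [multiplier_add, multKernel, mul_add, map_add, neg_add, add_mul] using hQ.add hR
  | monomial k a =>
    have hζ0 : ζ ≠ 0 := norm_pos_iff.1 (zero_lt_one.trans hζ)
    have hζ1 : 1 - ζ ≠ 0 := fun h => by simp [← sub_eq_zero.1 h] at hζ
    have hinv : ‖ζ⁻¹‖ < 1 := by rw [norm_inv]; exact inv_lt_one_of_one_lt₀ hζ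
    have hsum := (hasSum_choose_mul_geometric_of_norm_lt_one k hinv).mul_left
      (a * (-1) ^ k * ζ⁻¹ ^ (k + 1))
    have hlow : ∑ n ∈ Finset.range k,
        multiplier (monomial k a) (-((n : ℂ) + 1)) * ζ⁻¹ ^ (n + 1) = 0 :=
      Finset.sum_eq_zero fun n hn => by
        rw [multiplier_monomial, neg_add, neg_add_cancel_right, multichoose_neg_natCast,
          Nat.choose_eq_zero_of_lt (Finset.mem_range.1 hn)]
        simp
    rw [← hasSum_nat_add_iff' k, hlow, sub_zero]
    convert! hsum using 1
    · funext n
      rw [multiplier_monomial, neg_add, neg_add_cancel_right, multichoose_neg_natCast]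
      ring
    · have hsplit : 1 / (1 - ζ⁻¹) ^ (k + 1) =
          (-1) ^ (k + 1) * (1 - ζ)⁻¹ ^ (k + 1) * ζ ^ (k + 1) := by
        rw [one_div, ← inv_pow, ← mul_pow, ← mul_pow]
        congr 1
        have : ζ - 1 ≠ 0 := fun h => hζ1 (by linear_combination -h)
        field_simp
        ring
      have hcancel : ζ⁻¹ ^ (k + 1) * ζ ^ (k + 1) = 1 := by
        rw [← mul_pow, inv_mul_cancel₀ hζ0, one_pow]
      have hsign : (-1 : ℂ) ^ k * (-1) ^ (k + 1) = -1 := by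
        rw [pow_succ, ← mul_assoc, ← mul_pow]
        norm_num
      rw [multKernel, X_mul_monomial, aeval_monomial, hsplit, Complex.coe_algebraMap]
      linear_combination -(a * (1 - ζ)⁻¹ ^ (k + 1) * ((-1) ^ k * (-1) ^ (k + 1))) * hcancel -
        a * (1 - ζ)⁻¹ ^ (k + 1) * hsign

theorem coeff_mul_multichoose_le {Q : ℝ[X]} (hQ : ∀ k, 0 ≤ Q.coeff k) {x : ℝ} (hx : 0 ≤ x)
    (k : ℕ) : Q.coeff k * Ring.multichoose (x + 1) k ≤ ‖multiplier Q x‖ := by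
  have hterm : ∀ j, 0 ≤ Q.coeff j * Ring.multichoose (x + 1) j := fun j =>
    mul_nonneg (hQ j) (multichoose_add_one_nonneg hx j)
  have hreal : multiplier Q x =
      ((∑ j ∈ Q.support, Q.coeff j * Ring.multichoose (x + 1) j : ℝ) : ℂ) := by
    rw [multiplier, sum_def, Complex.ofReal_sum]
    refine Finset.sum_congr rfl fun j _ => ?_
    rw [Complex.ofReal_mul, ← Complex.ofRealHom_eq_coe (Ring.multichoose _ _),
      Ring.map_multichoose, Complex.ofRealHom_eq_coe, Complex.ofReal_add, Complex.ofReal_one]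
  rw [hreal, Complex.norm_real]
  refine le_trans ?_ (le_abs_self _)
  by_cases hk : k ∈ Q.support
  · exact Finset.single_le_sum (f := fun j => Q.coeff j * Ring.multichoose (x + 1) j)
      (fun j _ => hterm j) hk
  · rw [notMem_support_iff.1 hk, zero_mul]
    exact Finset.sum_nonneg fun j _ => hterm j

/-- `Q` has nonnegative coefficients and its multiplier is bounded by `e^{B + y x}` at `x ≥ 0`: the
data from which the kernel can be estimated at distance more than `6 y` from its pole. -/
structure HasExpType (Q : ℝ[X]) (B y : ℝ) : Prop where
  coeff_nonneg : ∀ k, 0 ≤ Q.coeff k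
  type_pos : 0 < y
  norm_le : ∀ x : ℝ, 0 ≤ x → ‖multiplier Q x‖ ≤ Real.exp (B + y * x)

theorem HasExpType.coeff_le {Q : ℝ[X]} {B y : ℝ} (h : HasExpType Q B y) (k : ℕ) :
    Q.coeff k ≤ Real.exp B * (Real.exp 1 * y) ^ k := by
  have hy := h.type_pos
  have hx : (0 : ℝ) ≤ k / y := by positivity
  -- `x = k / y` minimizes `exp (y * x) / x ^ k`
  have hle_k : Q.coeff k * y⁻¹ ^ k ≤ Real.exp (B + y * (k / y)) := calc
    Q.coeff k * y⁻¹ ^ k ≤ Q.coeff k * Ring.multichoose (k / y + 1) k := by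
      gcongr
      · exact h.coeff_nonneg k
      · exact pow_le_multichoose_add_one (inv_nonneg.2 hy.le) (div_eq_mul_inv _ _).ge
    _ ≤ _ := (coeff_mul_multichoose_le h.coeff_nonneg hx k).trans (h.norm_le _ hx)
  rw [mul_div_cancel₀ _ hy.ne', Real.exp_add, inv_pow, ← div_eq_mul_inv,
    div_le_iff₀ (pow_pos hy k)] at hle_k
  rwa [mul_pow, Real.exp_one_pow, ← mul_assoc]

theorem HasExpType.norm_multKernel_le {Q : ℝ[X]} {B y : ℝ} (h : HasExpType Q B y) {ζ : ℂ}
    (hζ : 6 * y ≤ ‖1 - ζ‖) : ‖multKernel Q ζ‖ ≤ 2 * Real.exp B / ‖1 - ζ‖ := by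
  have hy := h.type_pos
  have hpos : 0 < ‖1 - ζ‖ := by linarith
  have hratio : Real.exp 1 * y * ‖1 - ζ‖⁻¹ ≤ 1 / 2 := by
    rw [← div_eq_mul_inv, div_le_iff₀ hpos]
    nlinarith [Real.exp_one_lt_d9]
  have hterm : ∀ k, ‖algebraMap ℝ ℂ (Q.coeff k) * (1 - ζ)⁻¹ ^ k‖ ≤ Real.exp B * (1 / 2) ^ k := by
    intro k
    rw [norm_mul, norm_pow, norm_inv, norm_algebraMap', Real.norm_of_nonneg (h.coeff_nonneg k)]
    calc Q.coeff k * ‖1 - ζ‖⁻¹ ^ k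
        ≤ Real.exp B * (Real.exp 1 * y) ^ k * ‖1 - ζ‖⁻¹ ^ k := by
          gcongr
          exact h.coeff_le k
      _ = Real.exp B * (Real.exp 1 * y * ‖1 - ζ‖⁻¹) ^ k := by rw [mul_pow _ ‖1 - ζ‖⁻¹]; ring
      _ ≤ Real.exp B * (1 / 2) ^ k := by gcongr
  calc ‖multKernel Q ζ‖ = ‖1 - ζ‖⁻¹ * ‖aeval (1 - ζ)⁻¹ Q‖ := by
        rw [multKernel, map_mul, aeval_X, norm_mul, norm_inv]
    _ ≤ ‖1 - ζ‖⁻¹ * ∑ k ∈ Finset.range (Q.natDegree + 1), Real.exp B * (1 / 2) ^ k := by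
        gcongr
        rw [aeval_eq_sum_range]
        exact norm_sum_le_of_le _ fun k _ => by rw [Algebra.smul_def]; exact hterm k
    _ ≤ ‖1 - ζ‖⁻¹ * (Real.exp B * 2) := by
        rw [← Finset.mul_sum]
        gcongr
        exact sum_geometric_two_le _
    _ = 2 * Real.exp B / ‖1 - ζ‖ := by ring

/-! ### The transform of a function on the circle -/

/-- The point `e^{2πit}` of the unit circle, whose `n`-th power is `expo n t`. -/
noncomputable def circlePt (t : ℝ) : ℂ := Complex.exp (2 * Real.pi * t * Complex.I)

theorem norm_circlePt (t : ℝ) : ‖circlePt t‖ = 1 := by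
  rw [circlePt, ← Complex.ofReal_ofNat, ← Complex.ofReal_mul, ← Complex.ofReal_mul,
    Complex.norm_exp_ofReal_mul_I]

theorem circlePt_ne_zero (t : ℝ) : circlePt t ≠ 0 := Complex.exp_ne_zero _

theorem continuous_circlePt : Continuous circlePt := by
  unfold circlePt
  fun_prop

theorem norm_one_sub_div_circlePt (z : ℂ) (t : ℝ) : ‖1 - z / circlePt t‖ = ‖circlePt t - z‖ := by
  have h : 1 - z / circlePt t = (circlePt t - z) / circlePt t := by
    rw [sub_div, div_self (circlePt_ne_zero t)]
  rw [h, norm_div, norm_circlePt, div_one]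

theorem one_sub_norm_le_norm_circlePt_sub (z : ℂ) (t : ℝ) : 1 - ‖z‖ ≤ ‖circlePt t - z‖ := by
  simpa only [norm_circlePt] using norm_sub_norm_le (circlePt t) z

theorem norm_sub_one_le_norm_circlePt_sub (z : ℂ) (t : ℝ) : ‖z‖ - 1 ≤ ‖circlePt t - z‖ := by
  simpa only [norm_circlePt, norm_sub_rev z] using norm_sub_norm_le z (circlePt t)

/-- The integral over `A` of `g` against the kernel of the multiplier of `Q`: if `A` is the whole
circle, it continues analytically the series `∑ₙ P(n) ĝ(n) zⁿ`, where `P = multiplier Q`. -/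
noncomputable def multTransform (Q : ℝ[X]) (g : ℝ → ℂ) (A : Set ℝ) (z : ℂ) : ℂ :=
  ∫ t in A, g t * multKernel Q (z / circlePt t)

theorem measurable_aeval_one_sub_inv (R : ℝ[X]) : Measurable fun ζ : ℂ => aeval (1 - ζ)⁻¹ R :=
  R.continuous_aeval.measurable.comp (measurable_const.sub measurable_id).inv

theorem exists_norm_aeval_one_sub_inv_le (R : ℝ[X]) {δ : ℝ} (hδ : 0 < δ) :
    ∃ C, ∀ ζ : ℂ, δ ≤ ‖1 - ζ‖ → ‖aeval (1 - ζ)⁻¹ R‖ ≤ C := by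
  obtain ⟨C, hC⟩ := (isCompact_closedBall (0 : ℂ) δ⁻¹).exists_bound_of_continuousOn
    R.continuous_aeval.continuousOn
  refine ⟨C, fun ζ hζ => hC _ ?_⟩
  rw [mem_closedBall_zero_iff, norm_inv]
  exact inv_anti₀ hδ hζ

theorem hasDerivAt_multKernel (Q : ℝ[X]) {ζ : ℂ} (h : 1 - ζ ≠ 0) :
    HasDerivAt (multKernel Q) (aeval (1 - ζ)⁻¹ (derivative (X * Q) * X ^ 2)) ζ := by
  have hinv : HasDerivAt (fun ζ : ℂ => (1 - ζ)⁻¹) ((1 - ζ)⁻¹ ^ 2) ζ := by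
    convert! ((hasDerivAt_id ζ).const_sub 1).fun_inv h using 1
    simp
  have := ((X * Q).hasDerivAt_aeval (1 - ζ)⁻¹).comp ζ hinv
  rwa [map_mul, map_pow, aeval_X]

section
variable {g : ℝ → ℂ} {A : Set ℝ} {z : ℂ} {Q : ℝ[X]}

theorem aestronglyMeasurable_aeval_one_sub_div_circlePt (R : ℝ[X]) (z : ℂ) (μ : Measure ℝ) :
    AEStronglyMeasurable (fun t => aeval (1 - z / circlePt t)⁻¹ R) μ :=
  ((measurable_aeval_one_sub_inv R).comp
    (measurable_const.div continuous_circlePt.measurable)).aestronglyMeasurable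

theorem integrableOn_mul_multKernel (Q : ℝ[X]) (hA : MeasurableSet A) (hg : IntegrableOn g A)
    {δ : ℝ} (hδ : 0 < δ) (h : ∀ t ∈ A, δ ≤ ‖circlePt t - z‖) :
    IntegrableOn (fun t => g t * multKernel Q (z / circlePt t)) A := by
  obtain ⟨C, hC⟩ := exists_norm_aeval_one_sub_inv_le (X * Q) hδ
  refine hg.mul_bdd (c := C) (aestronglyMeasurable_aeval_one_sub_div_circlePt _ _ _) ?_
  filter_upwards [ae_restrict_mem hA] with t ht
  exact hC _ ((h t ht).trans_eq (norm_one_sub_div_circlePt z t).symm)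

theorem multTransform_union {A' : Set ℝ} (hA : MeasurableSet A) (hA' : MeasurableSet A')
    (hdis : Disjoint A A') (hg : IntegrableOn g A) (hg' : IntegrableOn g A') (hz : ‖z‖ ≠ 1) :
    multTransform Q g (A ∪ A') z = multTransform Q g A z + multTransform Q g A' z := by
  have hδ : 0 < |1 - ‖z‖| := abs_pos.2 (sub_ne_zero.2 hz.symm)
  have hdist : ∀ t, |1 - ‖z‖| ≤ ‖circlePt t - z‖ := fun t =>
    abs_sub_le_iff.2 ⟨one_sub_norm_le_norm_circlePt_sub z t, norm_sub_one_le_norm_circlePt_sub z t⟩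
  exact setIntegral_union hdis hA' (integrableOn_mul_multKernel Q hA hg hδ fun t _ => hdist t)
    (integrableOn_mul_multKernel Q hA' hg' hδ fun t _ => hdist t)

theorem multTransform_zero_right : multTransform Q g A 0 = (∫ t in A, g t) * multiplier Q 0 := by
  simp only [multTransform, zero_div, multKernel_zero_right, integral_mul_const]

theorem HasExpType.norm_multTransform_le {B y d : ℝ} (hQ : HasExpType Q B y)
    (hA : MeasurableSet A) (hg : IntegrableOn g A) (hd : 6 * y ≤ d)
    (hdist : ∀ t ∈ A, d ≤ ‖circlePt t - z‖) :
    ‖multTransform Q g A z‖ ≤ 2 * Real.exp B / d * ∫ t in A, ‖g t‖ := by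
  have hd0 : 0 < d := (mul_pos (by norm_num) hQ.type_pos).trans_le hd
  rw [← integral_const_mul]
  refine norm_integral_le_of_norm_le (hg.norm.const_mul _) ?_
  filter_upwards [ae_restrict_mem hA] with t ht
  have hdt : d ≤ ‖1 - z / circlePt t‖ := (hdist t ht).trans_eq (norm_one_sub_div_circlePt z t).symm
  rw [norm_mul, mul_comm]
  gcongr
  exact (hQ.norm_multKernel_le (hd.trans hdt)).trans (by gcongr)

theorem differentiableAt_multTransform (Q : ℝ[X]) (hA : MeasurableSet A) (hg : IntegrableOn g A)
    {δ : ℝ} (hδ : 0 < δ) (h : ∀ t ∈ A, δ ≤ ‖circlePt t - z‖) :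
    DifferentiableAt ℂ (multTransform Q g A) z := by
  have hball : ∀ v ∈ Metric.ball z (δ / 2), ∀ t ∈ A, δ / 2 ≤ ‖1 - v / circlePt t‖ := by
    intro v hv t ht
    rw [norm_one_sub_div_circlePt]
    have htri := norm_sub_le_norm_sub_add_norm_sub (circlePt t) v z
    rw [Metric.mem_ball, dist_eq_norm] at hv
    linarith [h t ht]
  obtain ⟨C, hC⟩ := exists_norm_aeval_one_sub_inv_le (derivative (X * Q) * X ^ 2) (half_pos hδ)
  refine (hasDerivAt_integral_of_dominated_loc_of_deriv_le (μ := volume.restrict A)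
    (F := fun v t => g t * multKernel Q (v / circlePt t))
    (F' := fun v t =>
      g t * (aeval (1 - v / circlePt t)⁻¹ (derivative (X * Q) * X ^ 2) * (circlePt t)⁻¹))
    (bound := fun t => ‖g t‖ * C)
    (Metric.ball_mem_nhds z (half_pos hδ)) ?_ ?_ ?_ ?_ ?_ ?_).2.differentiableAt
  · exact .of_forall fun v =>
      hg.aestronglyMeasurable.mul (aestronglyMeasurable_aeval_one_sub_div_circlePt _ _ _)
  · exact integrableOn_mul_multKernel Q hA hg hδ h
  · exact hg.aestronglyMeasurable.mul ((aestronglyMeasurable_aeval_one_sub_div_circlePt _ _ _).mul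
      continuous_circlePt.measurable.inv.aestronglyMeasurable)
  · filter_upwards [ae_restrict_mem hA] with t ht v hv
    rw [norm_mul, norm_mul, norm_inv, norm_circlePt, inv_one, mul_one]
    gcongr
    exact hC _ (hball v hv t ht)
  · exact hg.norm.mul_const _
  · filter_upwards [ae_restrict_mem hA] with t ht v hv
    have hne : 1 - v / circlePt t ≠ 0 := norm_pos_iff.1 ((half_pos hδ).trans_le (hball v hv t ht))
    have hdiv : HasDerivAt (fun v : ℂ => v / circlePt t) (circlePt t)⁻¹ v := by
      simpa using (hasDerivAt_id v).div_const (circlePt t)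
    exact ((hasDerivAt_multKernel Q hne).comp v hdiv).const_mul (g t)

theorem differentiableOn_multTransform (Q : ℝ[X]) (hA : MeasurableSet A) (hg : IntegrableOn g A) :
    DifferentiableOn ℂ (multTransform Q g A) (Metric.ball 0 1) := fun z hz =>
  (differentiableAt_multTransform Q hA hg (sub_pos.2 (mem_ball_zero_iff.1 hz)) fun t _ =>
    one_sub_norm_le_norm_circlePt_sub z t).differentiableWithinAt

theorem hasSum_multTransform (Q : ℝ[X]) (hg : IntegrableOn g A) (hz : 1 < ‖z‖) :
    HasSum (fun n : ℕ => multiplier Q (-((n : ℂ) + 1)) * z⁻¹ ^ (n + 1) *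
      ∫ t in A, g t * circlePt t ^ (n + 1)) (-multTransform Q g A z) := by
  have hterm : ∀ n : ℕ, multiplier Q (-((n : ℂ) + 1)) * z⁻¹ ^ (n + 1) *
      ∫ t in A, g t * circlePt t ^ (n + 1) =
      ∫ t in A, g t * (multiplier Q (-((n : ℂ) + 1)) * (z / circlePt t)⁻¹ ^ (n + 1)) := by
    intro n
    rw [← integral_const_mul]
    congr 1 with t
    rw [inv_div, div_eq_mul_inv, mul_pow]
    ring
  have hneg : -multTransform Q g A z = ∫ t in A, g t * -multKernel Q (z / circlePt t) := by
    simp only [mul_neg, integral_neg, multTransform]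
  simp only [hterm, hneg]
  refine hasSum_integral_of_dominated_convergence
    (fun n t => ‖g t‖ * ‖multiplier Q (-((n : ℂ) + 1)) * z⁻¹ ^ (n + 1)‖) ?_ ?_ ?_ ?_ ?_
  · intro n
    have := continuous_circlePt.measurable
    exact hg.aestronglyMeasurable.mul (Measurable.aestronglyMeasurable (by fun_prop))
  · refine fun n => .of_forall fun t => le_of_eq ?_
    simp only [norm_mul, norm_pow, norm_inv, norm_div, norm_circlePt, div_one]
  · exact .of_forall fun t => (hasSum_multiplier_neg Q hz).summable.norm.mul_left _
  · simp_rw [tsum_mul_left]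
    exact hg.norm.mul_const _
  · refine .of_forall fun t => (hasSum_multiplier_neg Q ?_).mul_left (g t)
    rwa [norm_div, norm_circlePt, div_one]

theorem norm_multTransform_le_of_forall_lt (hg : IntegrableOn g A) {C q ϑ : ℝ} (hC : 0 ≤ C)
    (hϑ0 : 0 ≤ ϑ) (hϑ1 : ϑ < 1) (hz : 1 < ‖z‖) (hqz : q ≤ ϑ * ‖z‖) (hq : 0 ≤ q)
    (hgrowth : ∀ n : ℕ, ‖multiplier Q (-((n : ℂ) + 1))‖ ≤ C * q ^ (n + 1)) {N : ℕ}
    (hN : ∀ n < N,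
      multiplier Q (-((n : ℂ) + 1)) = 0 ∨ ∫ t in A, g t * circlePt t ^ (n + 1) = 0) :
    ‖multTransform Q g A z‖ ≤ C * (∫ t in A, ‖g t‖) * ϑ ^ N * (1 - ϑ)⁻¹ := by
  have hterm : ∀ n : ℕ, ‖multiplier Q (-((n : ℂ) + 1)) * z⁻¹ ^ (n + 1) *
      ∫ t in A, g t * circlePt t ^ (n + 1)‖ ≤ C * ϑ ^ n * ∫ t in A, ‖g t‖ := by
    intro n
    have hmoment : ‖∫ t in A, g t * circlePt t ^ (n + 1)‖ ≤ ∫ t in A, ‖g t‖ :=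
      (norm_integral_le_integral_norm _).trans_eq (by simp [norm_circlePt])
    have hratio : q * ‖z‖⁻¹ ≤ ϑ := by
      rwa [← div_eq_mul_inv, div_le_iff₀ (by linarith)]
    have hcoeff : ‖multiplier Q (-((n : ℂ) + 1)) * z⁻¹ ^ (n + 1)‖ ≤ C * ϑ ^ n := by
      calc ‖multiplier Q (-((n : ℂ) + 1)) * z⁻¹ ^ (n + 1)‖
          ≤ C * q ^ (n + 1) * ‖z‖⁻¹ ^ (n + 1) := by
            rw [norm_mul, norm_pow, norm_inv]
            exact mul_le_mul_of_nonneg_right (hgrowth n) (by positivity)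
        _ = C * (q * ‖z‖⁻¹) ^ (n + 1) := by ring
        _ ≤ C * ϑ ^ (n + 1) := by gcongr
        _ ≤ C * ϑ ^ n := by
            gcongr C * ?_
            exact pow_le_pow_of_le_one hϑ0 hϑ1.le n.le_succ
    rw [norm_mul]
    exact mul_le_mul hcoeff hmoment (norm_nonneg _) (by positivity)
  have htail := (hasSum_nat_add_iff' N).2 (hasSum_multTransform Q hg hz)
  rw [Finset.sum_eq_zero fun n hn => by
    rcases hN n (Finset.mem_range.1 hn) with h | h <;> rw [h] <;> ring, sub_zero] at htail
  have hgeom := (hasSum_geometric_of_lt_one hϑ0 hϑ1).mul_left (C * (∫ t in A, ‖g t‖) * ϑ ^ N)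
  rw [← norm_neg]
  exact htail.norm_le_of_bounded hgeom fun n => (hterm (n + N)).trans_eq (by ring)

end

/-! ### Jensen's inequality and a two-constants estimate -/

theorem log_norm_le_circleAverage {f : ℂ → ℂ} {c : ℂ} {r : ℝ} (hr : r ≠ 0)
    (hf : AnalyticOnNhd ℂ f (Metric.closedBall c |r|)) (hfc : f c ≠ 0) :
    Real.log ‖f c‖ ≤ Real.circleAverage (fun z => Real.log ‖f z‖) c r := by
  rw [hf.circleAverage_log_norm hr hfc]
  refine le_add_of_nonneg_left (finsum_nonneg fun u => ?_)
  by_cases hu : u ∈ Metric.closedBall c |r|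
  · rcases eq_or_ne u c with rfl | hne
    · simp
    · refine mul_nonneg (mod_cast MeromorphicOn.AnalyticOnNhd.divisor_nonneg hf u) ?_
      rw [← Real.log_abs, abs_mul, abs_inv, abs_norm, ← div_eq_mul_inv]
      rw [Metric.mem_closedBall', dist_eq_norm] at hu
      exact Real.log_nonneg ((one_le_div (norm_pos_iff.2 (sub_ne_zero.2 hne.symm))).2 hu)
  · rw [Function.locallyFinsuppWithin.apply_eq_zero_of_notMem _ hu]
    simp

theorem ae_circleMap_ne_zero {f : ℂ → ℂ} {c : ℂ} {r : ℝ} (hr : r ≠ 0)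
    (hf : AnalyticOnNhd ℂ f (Metric.closedBall c |r|)) (hfc : f c ≠ 0) :
    ∀ᵐ θ : ℝ, f (circleMap c r θ) ≠ 0 := by
  have hball := hf.preimage_zero_mem_codiscreteWithin hfc (by simp)
    ((convex_closedBall c |r|).isConnected (Metric.nonempty_closedBall.2 (abs_nonneg r)))
  have hcircle := circleMap_preimage_codiscrete hr
    (Filter.codiscreteWithin_mono Metric.sphere_subset_closedBall hball)
  have hae := ae_restrict_le_codiscreteWithin (μ := (volume : Measure ℝ)) MeasurableSet.univ hcircle
  rwa [Measure.restrict_univ] at hae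

theorem circleMap_zero_two_pi_mul (r t : ℝ) :
    circleMap 0 r (2 * Real.pi * t) = r * circlePt t := by
  simp [circleMap, circlePt]

theorem circleAverage_eq_integral_circlePt (u : ℂ → ℝ) (r : ℝ) :
    Real.circleAverage u 0 r = ∫ t in (0 : ℝ)..1, u (r * circlePt t) := by
  have h := intervalIntegral.integral_comp_mul_left (a := 0) (b := 1)
    (fun θ => u (circleMap 0 r θ)) Real.two_pi_pos.ne'
  simp only [circleMap_zero_two_pi_mul, mul_zero, mul_one] at h
  rw [h, Real.circleAverage_def]

theorem log_norm_le_integral_of_le {f : ℂ → ℂ} {r : ℝ} (hr : r ≠ 0)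
    (hf : AnalyticOnNhd ℂ f (Metric.closedBall 0 |r|)) (hf0 : f 0 ≠ 0) {V : ℝ → ℝ}
    (hV : IntervalIntegrable V volume 0 1)
    (hfV : ∀ t ∈ Ioo (0 : ℝ) 1, f (r * circlePt t) ≠ 0 → Real.log ‖f (r * circlePt t)‖ ≤ V t) :
    Real.log ‖f 0‖ ≤ ∫ t in (0 : ℝ)..1, V t := by
  have hpi : 2 * Real.pi ≠ 0 := Real.two_pi_pos.ne'
  have hint : IntervalIntegrable (fun t => Real.log ‖f (r * circlePt t)‖) volume 0 1 := by
    have h := IntervalIntegrable.comp_mul_left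
      (hf.mono Metric.sphere_subset_closedBall).meromorphicOn.circleIntegrable_log_norm
      (c := 2 * Real.pi)
    simpa only [circleMap_zero_two_pi_mul, zero_div, div_self hpi] using h
  have hne : ∀ᵐ t : ℝ, f (r * circlePt t) ≠ 0 := by
    have h := (Measure.quasiMeasurePreserving_smul (volume : Measure ℝ) hpi).ae
      (ae_circleMap_ne_zero hr hf hf0)
    simpa only [smul_eq_mul, circleMap_zero_two_pi_mul] using h
  have hlog := log_norm_le_circleAverage hr hf hf0
  rw [circleAverage_eq_integral_circlePt] at hlog
  refine hlog.trans (intervalIntegral.integral_mono_ae_restrict zero_le_one hint hV ?_)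
  rw [Filter.EventuallyLE, ← restrict_Ioo_eq_restrict_Icc]
  filter_upwards [ae_restrict_mem measurableSet_Ioo, ae_restrict_of_ae hne] with t ht ht'
  exact hfV t ht ht'

theorem norm_add_mul_norm_le_norm_add {E : Type*} [NormedAddCommGroup E] [InnerProductSpace ℝ E]
    {w v : E} {c : ℝ} (hc0 : 0 ≤ c) (hc1 : c ≤ 1) (h : c * (‖w‖ * ‖v‖) ≤ inner ℝ w v) :
    ‖w‖ + c * ‖v‖ ≤ ‖w + v‖ := by
  refine (sq_le_sq₀ (by positivity) (norm_nonneg _)).1 ?_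
  rw [norm_add_sq_real]
  have hc : 0 ≤ (1 - c) * (1 + c) := mul_nonneg (sub_nonneg.2 hc1) (add_nonneg zero_le_one hc0)
  nlinarith [mul_nonneg hc (sq_nonneg ‖v‖)]

theorem exists_norm_add_I_pow_mul_ge (w u : ℂ) :
    ∃ k < 4, ‖w‖ + 7 / 10 * ‖u‖ ≤ ‖w + Complex.I ^ k * u‖ := by
  suffices h : ∃ k < 4, 7 / 10 * (‖w‖ * ‖u‖) ≤ inner ℝ w (Complex.I ^ k * u) by
    obtain ⟨k, hk, h⟩ := h
    have hu : ‖Complex.I ^ k * u‖ = ‖u‖ := by simp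
    exact ⟨k, hk, hu ▸ norm_add_mul_norm_le_norm_add (by norm_num) (by norm_num) (by rwa [hu])⟩
  set p := inner ℝ w u with hp
  set q := inner ℝ w (Complex.I * u) with hq
  have hpq : (‖w‖ * ‖u‖) ^ 2 = p ^ 2 + q ^ 2 := by
    rw [hp, hq, mul_pow, Complex.sq_norm, Complex.sq_norm]
    simp [Complex.inner, Complex.normSq_apply]
    ring
  by_contra! hcon
  have h0 : p < 7 / 10 * (‖w‖ * ‖u‖) := by simpa [hp] using hcon 0 (by norm_num)
  have h1 : q < 7 / 10 * (‖w‖ * ‖u‖) := by simpa [hq] using hcon 1 (by norm_num)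
  have h2 : -p < 7 / 10 * (‖w‖ * ‖u‖) := by simpa [hp] using hcon 2 (by norm_num)
  have h3 : -q < 7 / 10 * (‖w‖ * ‖u‖) := by
    simpa [hq, Complex.I_pow_three] using hcon 3 (by norm_num)
  nlinarith [sq_le_sq' (by linarith) h0.le, sq_le_sq' (by linarith) h1.le]

-- The product of `f` over the four rotations of the circle by right angles is bounded by
-- `M ^ 3 * δ` on the boundary, as one of the four points always lies on the small part.
theorem norm_pow_four_le {f : ℂ → ℂ} {w : ℂ} {R M δ : ℝ} (hR : 0 < R)
    (hf : ∀ v ∈ Metric.closedBall w R, DifferentiableAt ℂ f v)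
    (hM : ∀ v ∈ Metric.closedBall w R, ‖f v‖ ≤ M)
    (hδ : ∀ v ∈ Metric.closedBall w R, ‖w‖ + 7 / 10 * R ≤ ‖v‖ → ‖f v‖ ≤ δ) :
    ‖f w‖ ^ 4 ≤ M ^ 3 * δ := by
  have hM0 : 0 ≤ M := (norm_nonneg _).trans (hM w (Metric.mem_closedBall_self hR.le))
  have hmem : ∀ (k : ℕ), ∀ u ∈ Metric.closedBall (0 : ℂ) R,
      w + Complex.I ^ k * u ∈ Metric.closedBall w R := fun k u hu => by
    simpa [dist_eq_norm] using hu
  set G : ℂ → ℂ := fun u => ∏ k ∈ Finset.range 4, f (w + Complex.I ^ k * u) with hG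
  have hGd : DiffContOnCl ℂ G (Metric.ball 0 R) := by
    refine DifferentiableOn.diffContOnCl fun u hu => DifferentiableAt.differentiableWithinAt ?_
    rw [closure_ball _ hR.ne'] at hu
    exact DifferentiableAt.fun_finsetProd fun k _ =>
      (hf _ (hmem k u hu)).comp (f := fun u => w + Complex.I ^ k * u) u (by fun_prop)
  have hbound : ∀ u ∈ frontier (Metric.ball (0 : ℂ) R), ‖G u‖ ≤ M ^ 3 * δ := by
    intro u hu
    rw [frontier_ball _ hR.ne'] at hu
    have huc := Metric.sphere_subset_closedBall hu
    obtain ⟨k, hk, hkn⟩ := exists_norm_add_I_pow_mul_ge w u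
    rw [mem_sphere_zero_iff_norm.1 hu] at hkn
    rw [hG, norm_prod, ← Finset.prod_erase_mul _ _ (Finset.mem_range.2 hk)]
    refine mul_le_mul ?_ (hδ _ (hmem k u huc) hkn) (norm_nonneg _) (by positivity)
    exact (Finset.prod_le_prod (fun _ _ => norm_nonneg _) fun j _ => hM _ (hmem j u huc)).trans_eq
      (by rw [Finset.prod_const, Finset.card_erase_of_mem (Finset.mem_range.2 hk),
        Finset.card_range])
  have h := Complex.norm_le_of_forall_mem_frontier_norm_le Metric.isBounded_ball hGd hbound
    (subset_closure (Metric.mem_ball_self hR))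
  simpa [hG] using h

/-! ### The exponential type of `∏ (1 + x / γ)` at a given scale -/

/-- An exponential type of the product `∏ γ ∈ U, (1 + x / γ)`, chosen so that the product is
bounded by the constant `exp (scaleLog U 0 ε ρ)` times an exponential of this type. The parameter
`ρ` stands for the distance to the point `1` at which the multiplier kernel is estimated. -/
noncomputable def scaleType (U : Finset ℕ) (ε ρ : ℝ) : ℝ :=
  ∑ γ ∈ U, min (ρ ^ 2) (1 / (γ : ℝ)) + ε * ρ ^ 2 / 24

/-- The logarithm of the constant that goes with the exponential type `scaleType U ε ρ`, when the
product has up to `m` factors besides those of `U`. -/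
noncomputable def scaleLog (U : Finset ℕ) (m : ℕ) (ε ρ : ℝ) : ℝ :=
  ∑ γ ∈ U, posLog (1 / (γ * ρ ^ 2)) + m * Real.log (24 * (m + 1) / (ε * ρ ^ 2))

theorem le_scaleType (U : Finset ℕ) (ε ρ : ℝ) : ε * ρ ^ 2 / 24 ≤ scaleType U ε ρ :=
  le_add_of_nonneg_left (Finset.sum_nonneg fun γ _ => by positivity)

theorem scaleType_pos {U : Finset ℕ} {ε ρ : ℝ} (hε : 0 < ε) (hρ : 0 < ρ) :
    0 < scaleType U ε ρ :=
  (by positivity : 0 < ε * ρ ^ 2 / 24).trans_le (le_scaleType U ε ρ)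

theorem one_add_mul_le_exp_log_div_add {a b : ℝ} (ha : 0 < a) (hab : a ≤ b) (x : ℝ) :
    1 + b * x ≤ Real.exp (Real.log (b / a) + a * x) := by
  have hratio : 1 ≤ b / a := (one_le_div ha).2 hab
  rw [Real.exp_add, Real.exp_log (by positivity)]
  calc 1 + b * x = 1 + b / a * (a * x) := by field_simp
    _ ≤ b / a * (a * x + 1) := by linarith
    _ ≤ b / a * Real.exp (a * x) := by
      gcongr
      exact Real.add_one_le_exp _

theorem one_add_div_le_exp_posLog_add_min (γ : ℝ) {ρ : ℝ} (hρ : 0 < ρ) (x : ℝ) :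
    1 + x / γ ≤ Real.exp (posLog (1 / (γ * ρ ^ 2)) + min (ρ ^ 2) (1 / γ) * x) := by
  rcases le_total (ρ ^ 2) (1 / γ) with h | h
  · rw [min_eq_left h, div_eq_inv_mul, ← one_div]
    refine (one_add_mul_le_exp_log_div_add (pow_pos hρ 2) h x).trans ?_
    rw [div_div]
    gcongr
    exact le_max_right _ _
  · rw [min_eq_right h, div_eq_inv_mul, ← one_div]
    calc 1 + 1 / γ * x ≤ Real.exp (1 / γ * x) := by linarith [Real.add_one_le_exp (1 / γ * x)]
      _ ≤ Real.exp (posLog (1 / (γ * ρ ^ 2)) + 1 / γ * x) :=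
        Real.exp_le_exp.2 (le_add_of_nonneg_left Real.posLog_nonneg)

theorem prod_one_add_div_le_exp_of_card_le {V : Finset ℕ} (hV : ∀ γ ∈ V, 1 ≤ γ) {m : ℕ}
    (hm : V.card ≤ m) {δ x : ℝ} (hδ : 0 < δ) (hδm : δ ≤ m + 1) (hx : 0 ≤ x) :
    ∏ γ ∈ V, (1 + x / (γ : ℝ)) ≤ Real.exp (m * Real.log ((m + 1) / δ) + δ * x) := by
  set a := δ / (m + 1) with ha
  have ha0 : 0 < a := by positivity
  have ha1 : a ≤ 1 := (div_le_one (by positivity)).2 hδm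
  have hlog : 0 ≤ Real.log (1 / a) := Real.log_nonneg ((one_le_div ha0).2 ha1)
  have hfactor : ∀ γ ∈ V, 1 + x / (γ : ℝ) ≤ Real.exp (Real.log (1 / a) + a * x) := fun γ hγ =>
    calc 1 + x / (γ : ℝ) ≤ 1 + 1 * x := by
          rw [one_mul]
          gcongr
          exact div_le_self hx (by exact_mod_cast hV γ hγ)
      _ ≤ Real.exp (Real.log (1 / a) + a * x) := one_add_mul_le_exp_log_div_add ha0 ha1 x
  calc ∏ γ ∈ V, (1 + x / (γ : ℝ)) ≤ ∏ _γ ∈ V, Real.exp (Real.log (1 / a) + a * x) :=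
        Finset.prod_le_prod (fun γ _ => by positivity) hfactor
    _ ≤ Real.exp (Real.log (1 / a) + a * x) ^ m := by
        rw [Finset.prod_const]
        exact pow_le_pow_right₀ (Real.one_le_exp (by positivity)) hm
    _ = Real.exp (m * Real.log ((m + 1) / δ) + m * a * x) := by
        rw [← Real.exp_nat_mul, ha, one_div_div]
        ring_nf
    _ ≤ Real.exp (m * Real.log ((m + 1) / δ) + δ * x) := by
        gcongr
        rw [ha, mul_div_assoc', div_le_iff₀ (by positivity)]
        linarith

theorem norm_prod_one_add_div_le {S : Finset ℕ} (hS : ∀ γ ∈ S, 1 ≤ γ) (T : Finset ℕ) {ε ρ : ℝ}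
    (hε : 0 < ε) (hε1 : ε ≤ 1) (hρ : 0 < ρ) (hρ2 : ρ ≤ 2) (x : ℂ) :
    ‖∏ γ ∈ S, (1 + x / (γ : ℂ))‖ ≤
      Real.exp (scaleLog (S \ T) T.card ε ρ + scaleType (S \ T) ε ρ * ‖x‖) := by
  have hsparse : ∏ γ ∈ S \ T, (1 + ‖x‖ / (γ : ℝ)) ≤
      Real.exp (∑ γ ∈ S \ T, (posLog (1 / (γ * ρ ^ 2)) + min (ρ ^ 2) (1 / (γ : ℝ)) * ‖x‖)) := by
    rw [Real.exp_sum]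
    exact Finset.prod_le_prod (fun γ _ => by positivity) fun γ _ =>
      one_add_div_le_exp_posLog_add_min γ hρ _
  have hexceptional : ∏ γ ∈ S ∩ T, (1 + ‖x‖ / (γ : ℝ)) ≤
      Real.exp (T.card * Real.log ((T.card + 1) / (ε * ρ ^ 2 / 24)) + ε * ρ ^ 2 / 24 * ‖x‖) :=
    prod_one_add_div_le_exp_of_card_le (fun γ hγ => hS γ (Finset.mem_inter.1 hγ).1)
      (Finset.card_le_card Finset.inter_subset_right) (by positivity)
      (by nlinarith [Nat.cast_nonneg (α := ℝ) T.card]) (norm_nonneg x)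
  calc ‖∏ γ ∈ S, (1 + x / (γ : ℂ))‖ ≤ ∏ γ ∈ S, (1 + ‖x‖ / (γ : ℝ)) := by
        rw [norm_prod]
        exact Finset.prod_le_prod (fun _ _ => norm_nonneg _) fun γ _ =>
          (norm_add_le _ _).trans_eq (by simp)
    _ = (∏ γ ∈ S \ T, (1 + ‖x‖ / (γ : ℝ))) * ∏ γ ∈ S ∩ T, (1 + ‖x‖ / (γ : ℝ)) := by
        rw [← Finset.prod_sdiff (Finset.inter_subset_left : S ∩ T ⊆ S),
          Finset.sdiff_inter_self_left]
    _ ≤ _ := mul_le_mul hsparse hexceptional (Finset.prod_nonneg fun γ _ => by positivity)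
        (Real.exp_pos _).le
    _ = Real.exp (scaleLog (S \ T) T.card ε ρ + scaleType (S \ T) ε ρ * ‖x‖) := by
        rw [← Real.exp_add, Finset.sum_add_distrib, ← Finset.sum_mul, scaleLog, scaleType,
          div_div_eq_mul_div, mul_comm ((T.card : ℝ) + 1) 24]
        congr 1
        ring

/-- The polynomial `Q` represents the multiplier `∏ γ ∈ S, (1 + x / γ)`, with nonnegative
coefficients. -/
structure IsProdMultiplier (S : Finset ℕ) (Q : ℝ[X]) : Prop where
  one_le : ∀ γ ∈ S, 1 ≤ γ
  coeff_nonneg : ∀ k, 0 ≤ Q.coeff k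
  multiplier_eq : ∀ x, multiplier Q x = ∏ γ ∈ S, (1 + x / (γ : ℂ))

theorem IsProdMultiplier.hasExpType {S : Finset ℕ} {Q : ℝ[X]} (hQ : IsProdMultiplier S Q)
    (T : Finset ℕ) {ε ρ : ℝ} (hε : 0 < ε) (hε1 : ε ≤ 1) (hρ : 0 < ρ) (hρ2 : ρ ≤ 2) :
    HasExpType Q (scaleLog (S \ T) T.card ε ρ) (scaleType (S \ T) ε ρ) where
  coeff_nonneg := hQ.coeff_nonneg
  type_pos := scaleType_pos hε hρ
  norm_le x hx := by
    have h := norm_prod_one_add_div_le hQ.one_le T hε hε1 hρ hρ2 (x : ℂ)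
    rwa [← hQ.multiplier_eq, Complex.norm_real, Real.norm_of_nonneg hx] at h

/-! ### Moving the points of the disc inwards -/

/-- A function whose real part is at least `12 * scaleType U ε ‖s‖` at `s = 1 - z`, `‖z‖ ≤ 1`. -/
noncomputable def pushExponent (U : Finset ℕ) (ε : ℝ) (s : ℂ) : ℂ :=
  ε * s + 48 * ∑ γ ∈ U, s / ((√(γ : ℝ) : ℂ) + γ * s)

/-- A map of the unit disc into itself. It moves a point `z` inwards by an amount comparable to
`scaleType U ε ‖1 - z‖`, which is the distance to the circle required by
`HasExpType.norm_multKernel_le`. -/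
noncomputable def pushMap (U : Finset ℕ) (ε : ℝ) (z : ℂ) : ℂ :=
  z * Complex.exp (-pushExponent U ε (1 - z))

theorem pushMap_zero (U : Finset ℕ) (ε : ℝ) : pushMap U ε 0 = 0 := by
  simp [pushMap]

theorem norm_sq_div_two_le_re_one_sub {z : ℂ} (hz : ‖z‖ ≤ 1) : ‖1 - z‖ ^ 2 / 2 ≤ (1 - z).re := by
  have h : ‖1 - z‖ ^ 2 = 1 - 2 * z.re + ‖z‖ ^ 2 := by
    simp only [Complex.sq_norm, Complex.normSq_apply, Complex.sub_re, Complex.sub_im,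
      Complex.one_re, Complex.one_im]
    ring
  rw [h, Complex.sub_re, Complex.one_re]
  nlinarith [norm_nonneg z]

section

variable {U : Finset ℕ} {ε : ℝ} {s z : ℂ}

theorem le_norm_ofReal_add_natCast_mul {q : ℝ} (hs : 0 ≤ s.re) (γ : ℕ) :
    q ≤ ‖(q : ℂ) + γ * s‖ :=
  le_trans (by
    simp only [Complex.add_re, Complex.ofReal_re, Complex.mul_re, Complex.natCast_re,
      Complex.natCast_im, zero_mul, sub_zero, le_add_iff_nonneg_right]
    positivity) (Complex.re_le_norm _)

theorem min_div_four_mul_sq_le {q : ℝ} (hq : 0 < q) {ρ : ℝ} (hρ : 0 ≤ ρ) :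
    min (ρ ^ 2) (1 / q ^ 2) / 4 * (q + q ^ 2 * ρ) ^ 2 ≤ q ^ 2 * ρ ^ 2 := by
  rcases le_total (q * ρ) 1 with h | h
  · calc min (ρ ^ 2) (1 / q ^ 2) / 4 * (q + q ^ 2 * ρ) ^ 2
        = min (ρ ^ 2) (1 / q ^ 2) / 4 * (q + q * (q * ρ)) ^ 2 := by ring
      _ ≤ ρ ^ 2 / 4 * (q + q * 1) ^ 2 := by
          gcongr
          exact min_le_left _ _
      _ = q ^ 2 * ρ ^ 2 := by ring
  · calc min (ρ ^ 2) (1 / q ^ 2) / 4 * (q + q ^ 2 * ρ) ^ 2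
        = min (ρ ^ 2) (1 / q ^ 2) / 4 * (q * 1 + q ^ 2 * ρ) ^ 2 := by rw [mul_one]
      _ ≤ (1 / q ^ 2) / 4 * (q * (q * ρ) + q ^ 2 * ρ) ^ 2 := by
          gcongr
          exact min_le_right _ _
      _ = q ^ 2 * ρ ^ 2 := by field_simp; ring

theorem min_div_four_le_re_div_sqrt_add_mul {γ : ℕ} (hγ : 1 ≤ γ) (hs : 0 ≤ s.re) :
    min (‖s‖ ^ 2) (1 / (γ : ℝ)) / 4 ≤ (s / ((√(γ : ℝ) : ℂ) + γ * s)).re := by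
  set q := √(γ : ℝ)
  have hq0 : 0 < q := Real.sqrt_pos.2 (by exact_mod_cast hγ)
  have hq2 : (γ : ℝ) = q ^ 2 := (Real.sq_sqrt γ.cast_nonneg).symm
  set D : ℂ := (q : ℂ) + γ * s with hD
  have hD0 : 0 < ‖D‖ := hq0.trans_le (le_norm_ofReal_add_natCast_mul hs γ)
  have hDle : ‖D‖ ≤ q + q ^ 2 * ‖s‖ := (norm_add_le _ _).trans_eq (by
    rw [norm_mul, Complex.norm_real, Complex.norm_natCast, Real.norm_of_nonneg hq0.le, hq2])
  have hre : (s / D).re = (q * s.re + γ * ‖s‖ ^ 2) / ‖D‖ ^ 2 := by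
    rw [Complex.div_re, ← Complex.normSq_eq_norm_sq D, ← Complex.normSq_eq_norm_sq s,
      Complex.normSq_apply s, hD]
    simp
    ring
  rw [hre, le_div_iff₀ (by positivity)]
  calc min (‖s‖ ^ 2) (1 / (γ : ℝ)) / 4 * ‖D‖ ^ 2
      ≤ min (‖s‖ ^ 2) (1 / (γ : ℝ)) / 4 * (q + q ^ 2 * ‖s‖) ^ 2 := by gcongr
    _ ≤ γ * ‖s‖ ^ 2 := by
        rw [hq2]
        exact min_div_four_mul_sq_le hq0 (norm_nonneg s)
    _ ≤ q * s.re + γ * ‖s‖ ^ 2 := le_add_of_nonneg_left (by positivity)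

/-- The smallness condition on a finite set `U` of frequencies and a parameter `ε` under which
`pushMap U ε` moves a point by at most a small multiple of its distance to `1`. -/
structure IsSparse (U : Finset ℕ) (ε : ℝ) : Prop where
  one_le : ∀ γ ∈ U, 1 ≤ γ
  eps_pos : 0 < ε
  sum_le : ε + 48 * ∑ γ ∈ U, 1 / √(γ : ℝ) ≤ 1 / 100

theorem IsSparse.eps_le_one (hU : IsSparse U ε) : ε ≤ 1 := by
  have h : 0 ≤ ∑ γ ∈ U, 1 / √(γ : ℝ) := Finset.sum_nonneg fun γ _ => by positivity
  linarith [hU.sum_le]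

theorem IsSparse.mul_scaleType_le_re_pushExponent (hU : IsSparse U ε) (hs : ‖s‖ ^ 2 / 2 ≤ s.re) :
    12 * scaleType U ε ‖s‖ ≤ (pushExponent U ε s).re := by
  have hs0 : 0 ≤ s.re := le_trans (by positivity) hs
  have hre : (pushExponent U ε s).re =
      ε * s.re + 48 * ∑ γ ∈ U, (s / ((√(γ : ℝ) : ℂ) + γ * s)).re := by
    simp [pushExponent, Complex.re_sum]
  have hsum : ∑ γ ∈ U, min (‖s‖ ^ 2) (1 / (γ : ℝ)) / 4 ≤
      ∑ γ ∈ U, (s / ((√(γ : ℝ) : ℂ) + γ * s)).re :=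
    Finset.sum_le_sum fun γ hγ => min_div_four_le_re_div_sqrt_add_mul (hU.one_le γ hγ) hs0
  rw [← Finset.sum_div] at hsum
  rw [hre, scaleType]
  nlinarith [hU.eps_pos]

theorem IsSparse.norm_pushExponent_le (hU : IsSparse U ε) (hs : 0 ≤ s.re) :
    ‖pushExponent U ε s‖ ≤ ‖s‖ / 100 := by
  have hterm : ∀ γ ∈ U, ‖s / ((√(γ : ℝ) : ℂ) + γ * s)‖ ≤ 1 / √(γ : ℝ) * ‖s‖ := by
    intro γ hγ
    have hsqrt : 0 < √(γ : ℝ) := Real.sqrt_pos.2 (by exact_mod_cast hU.one_le γ hγ)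
    rw [norm_div, one_div_mul_eq_div]
    gcongr
    exact le_norm_ofReal_add_natCast_mul hs γ
  calc ‖pushExponent U ε s‖ ≤ ε * ‖s‖ + 48 * ∑ γ ∈ U, 1 / √(γ : ℝ) * ‖s‖ := by
        refine (norm_add_le _ _).trans ?_
        rw [norm_mul, norm_mul, Complex.norm_real, Real.norm_of_nonneg hU.eps_pos.le,
          Complex.norm_ofNat]
        gcongr
        exact norm_sum_le_of_le _ hterm
    _ = (ε + 48 * ∑ γ ∈ U, 1 / √(γ : ℝ)) * ‖s‖ := by rw [← Finset.sum_mul]; ring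
    _ ≤ 1 / 100 * ‖s‖ := by gcongr; exact hU.sum_le
    _ = ‖s‖ / 100 := by ring

theorem IsSparse.norm_pushExponent_one_sub_le (hU : IsSparse U ε) (hz : ‖z‖ ≤ 1) :
    ‖pushExponent U ε (1 - z)‖ ≤ ‖1 - z‖ / 100 :=
  hU.norm_pushExponent_le (le_trans (by positivity) (norm_sq_div_two_le_re_one_sub hz))

theorem norm_one_sub_le_two (hz : ‖z‖ ≤ 1) : ‖1 - z‖ ≤ 2 :=
  (norm_sub_le _ _).trans (by rw [norm_one]; linarith)

theorem IsSparse.scaleType_le (hU : IsSparse U ε) (hz : ‖z‖ ≤ 1) :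
    scaleType U ε ‖1 - z‖ ≤ ‖1 - z‖ / 1200 := by
  have hre := hU.mul_scaleType_le_re_pushExponent (norm_sq_div_two_le_re_one_sub hz)
  linarith [hU.norm_pushExponent_one_sub_le hz, Complex.re_le_norm (pushExponent U ε (1 - z))]

theorem exp_neg_le_one_sub_half {x : ℝ} (hx0 : 0 ≤ x) (hx1 : x ≤ 1 / 2) :
    Real.exp (-x) ≤ 1 - x / 2 := by
  have h := Real.abs_exp_sub_one_sub_id_le (x := -x) (by rw [abs_neg, abs_of_nonneg hx0]; linarith)
  nlinarith [(abs_le.1 h).2]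

theorem IsSparse.norm_pushMap_le (hU : IsSparse U ε) (hz : ‖z‖ ≤ 1) :
    ‖pushMap U ε z‖ ≤ 1 - 6 * scaleType U ε ‖1 - z‖ := by
  have hlower := hU.mul_scaleType_le_re_pushExponent (norm_sq_div_two_le_re_one_sub hz)
  have hupper := hU.norm_pushExponent_one_sub_le hz
  set x := (pushExponent U ε (1 - z)).re
  have hε := hU.eps_pos
  have hx0 : 0 ≤ x := by
    have : (0 : ℝ) ≤ ε * ‖1 - z‖ ^ 2 / 24 := by positivity
    linarith [le_scaleType U ε ‖1 - z‖]
  have hx1 : x ≤ 1 / 2 := by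
    linarith [Complex.re_le_norm (pushExponent U ε (1 - z)), norm_one_sub_le_two hz]
  calc ‖pushMap U ε z‖ = ‖z‖ * Real.exp (-x) := by
        rw [pushMap, norm_mul, Complex.norm_exp, Complex.neg_re]
    _ ≤ 1 * (1 - x / 2) := by
        gcongr
        exact exp_neg_le_one_sub_half hx0 hx1
    _ ≤ 1 - 6 * scaleType U ε ‖1 - z‖ := by linarith

theorem IsSparse.norm_pushMap_sub_le (hU : IsSparse U ε) (hz : ‖z‖ ≤ 1) :
    ‖pushMap U ε z - z‖ ≤ ‖1 - z‖ / 50 := by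
  have hE := hU.norm_pushExponent_one_sub_le hz
  have hexp := Complex.norm_exp_sub_one_le (x := -pushExponent U ε (1 - z))
    (by rw [norm_neg]; linarith [norm_one_sub_le_two hz])
  rw [norm_neg] at hexp
  calc ‖pushMap U ε z - z‖ = ‖z‖ * ‖Complex.exp (-pushExponent U ε (1 - z)) - 1‖ := by
        rw [pushMap, ← mul_sub_one, norm_mul]
    _ ≤ 1 * (2 * ‖pushExponent U ε (1 - z)‖) := by gcongr
    _ ≤ ‖1 - z‖ / 50 := by linarith

theorem differentiableOn_pushMap (hU : ∀ γ ∈ U, 1 ≤ γ) :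
    DifferentiableOn ℂ (pushMap U ε) (Metric.ball 0 1) := by
  intro z hz
  rw [mem_ball_zero_iff] at hz
  have hre : 0 ≤ (1 - z).re := le_trans (by positivity) (norm_sq_div_two_le_re_one_sub hz.le)
  have hsum : DifferentiableAt ℂ
      (fun z => ∑ γ ∈ U, (1 - z) / ((√(γ : ℝ) : ℂ) + γ * (1 - z))) z := by
    refine DifferentiableAt.fun_sum fun γ hγ => ?_
    have hsqrt : 0 < √(γ : ℝ) := Real.sqrt_pos.2 (by exact_mod_cast hU γ hγ)
    have hden : (√(γ : ℝ) : ℂ) + γ * (1 - z) ≠ 0 :=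
      norm_pos_iff.1 (hsqrt.trans_le (le_norm_ofReal_add_natCast_mul hre γ))
    fun_prop (disch := assumption)
  refine DifferentiableAt.differentiableWithinAt ?_
  unfold pushMap pushExponent
  fun_prop

end

/-! ### The transform at pushed points -/

theorem norm_circlePt_sub_circlePt (t s : ℝ) :
    ‖circlePt t - circlePt s‖ = 2 * |Real.sin (Real.pi * (t - s))| := by
  have h : circlePt t - circlePt s =
      circlePt s * (Complex.exp (Complex.I * ((2 * Real.pi * (t - s) : ℝ) : ℂ)) - 1) := by
    rw [mul_sub, mul_one, circlePt, circlePt, ← Complex.exp_add]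
    congr 2
    push_cast
    ring
  rw [h, norm_mul, norm_circlePt, one_mul, Complex.norm_exp_I_mul_ofReal_sub_one, norm_mul,
    Real.norm_eq_abs, Real.norm_eq_abs, abs_two]
  congr 3
  ring

theorem norm_circlePt_sub_one (t : ℝ) : ‖circlePt t - 1‖ = 2 * |Real.sin (Real.pi * t)| := by
  simpa [circlePt] using norm_circlePt_sub_circlePt t 0

theorem norm_ofReal_mul_circlePt {r : ℝ} (hr : 0 ≤ r) (t : ℝ) : ‖(r : ℂ) * circlePt t‖ = r := by
  rw [norm_mul, norm_circlePt, Complex.norm_real, Real.norm_of_nonneg hr, mul_one]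

theorem norm_circlePt_sub_ofReal_mul_circlePt {r : ℝ} (hr : r ≤ 1) (t : ℝ) :
    ‖circlePt t - r * circlePt t‖ = 1 - r := by
  rw [← one_sub_mul, ← Complex.ofReal_one, ← Complex.ofReal_sub,
    norm_ofReal_mul_circlePt (sub_nonneg.2 hr)]

theorem two_mul_le_sin_pi_mul {t : ℝ} (h0 : 0 ≤ t) (h1 : t ≤ 1 / 2) :
    2 * t ≤ Real.sin (Real.pi * t) := by
  have hpi := Real.pi_pos
  calc 2 * t = 2 / Real.pi * (Real.pi * t) := by field_simp
    _ ≤ Real.sin (Real.pi * t) := Real.mul_le_sin (by positivity) (by nlinarith)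

theorem two_mul_min_le_sin_pi_mul {t : ℝ} (ht : t ∈ Icc (0 : ℝ) 1) :
    2 * min t (1 - t) ≤ Real.sin (Real.pi * t) := by
  rcases le_total t (1 / 2) with h | h
  · exact (mul_le_mul_of_nonneg_left (min_le_left _ _) zero_le_two).trans
      (two_mul_le_sin_pi_mul ht.1 h)
  · rw [← Real.sin_pi_sub, ← mul_one_sub]
    exact (mul_le_mul_of_nonneg_left (min_le_right _ _) zero_le_two).trans
      (two_mul_le_sin_pi_mul (sub_nonneg.2 ht.2) (by linarith))

theorem min_le_norm_one_sub {t r : ℝ} (ht : t ∈ Icc (0 : ℝ) 1) (hr0 : 0 ≤ r) (hr1 : r ≤ 1) :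
    min t (1 - t) ≤ ‖1 - r * circlePt t‖ := by
  have hradial : 1 - r ≤ ‖1 - r * circlePt t‖ := by
    simpa only [norm_one, norm_ofReal_mul_circlePt hr0] using
      norm_sub_norm_le (1 : ℂ) (r * circlePt t)
  have htriangle := norm_sub_le_norm_sub_add_norm_sub (circlePt t) (r * circlePt t) 1
  rw [norm_circlePt_sub_ofReal_mul_circlePt hr1, norm_sub_rev (r * circlePt t) 1,
    norm_circlePt_sub_one] at htriangle
  linarith [two_mul_min_le_sin_pi_mul ht, le_abs_self (Real.sin (Real.pi * t)),
    le_min ht.1 (sub_nonneg.2 ht.2)]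

theorem norm_circlePt_sub_one_le {s t : ℝ} (hs : 0 ≤ s) (hs1 : s ≤ 1 / 4)
    (ht : t ∈ Ico (2 * s) 1) : ‖circlePt s - 1‖ ≤ ‖circlePt t - circlePt s‖ := by
  obtain ⟨hst, ht1⟩ := ht
  have hpi := Real.pi_pos
  rw [norm_circlePt_sub_one, norm_circlePt_sub_circlePt,
    abs_of_nonneg (Real.sin_nonneg_of_nonneg_of_le_pi (by positivity) (by nlinarith))]
  refine mul_le_mul_of_nonneg_left (le_trans ?_ (le_abs_self _)) zero_le_two
  rcases le_total (t - s) (1 / 2) with h | h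
  · exact Real.sin_le_sin_of_le_of_le_pi_div_two (by nlinarith) (by nlinarith) (by gcongr; linarith)
  · rw [← Real.sin_pi_sub (Real.pi * (t - s))]
    exact Real.sin_le_sin_of_le_of_le_pi_div_two (by nlinarith) (by nlinarith) (by nlinarith)

theorem le_norm_circlePt_sub_of_mem_Ico {s t : ℝ} {z w v : ℂ} (hs : 0 ≤ s) (hs1 : s ≤ 1 / 4)
    (ht : t ∈ Ico (2 * s) 1) (hz : ‖circlePt s - z‖ ≤ ‖1 - z‖ / 100)
    (hw : ‖w - z‖ ≤ ‖1 - z‖ / 50) (hv : ‖v - w‖ ≤ ‖1 - z‖ / 10) :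
    4 / 5 * ‖1 - z‖ ≤ ‖circlePt t - v‖ := by
  have hone : ‖1 - z‖ ≤ ‖circlePt s - 1‖ + ‖circlePt s - z‖ := by
    simpa only [norm_sub_rev 1 (circlePt s)] using
      norm_sub_le_norm_sub_add_norm_sub 1 (circlePt s) z
  have htv := norm_sub_le_norm_sub_add_norm_sub (circlePt t) v (circlePt s)
  have hvw := norm_sub_le_norm_sub_add_norm_sub v w (circlePt s)
  have hwz := norm_sub_le_norm_sub_add_norm_sub w z (circlePt s)
  rw [norm_sub_rev z] at hwz
  linarith [norm_circlePt_sub_one_le hs hs1 ht, norm_nonneg (1 - z)]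

section

variable {Q : ℝ[X]} {g : ℝ → ℂ} {A A' : Set ℝ} {B y : ℝ}

-- Outside the disc the part of the transform coming from `A'` is small because the whole transform
-- and the part coming from `A` are, and smallness propagates inside by `norm_pow_four_le`.
theorem HasExpType.norm_multTransform_pow_four_le (hQ : HasExpType Q B y) (hA : MeasurableSet A)
    (hA' : MeasurableSet A') (hdisj : Disjoint A A') (hg : IntegrableOn g A)
    (hg' : IntegrableOn g A') {w : ℂ} {R δ : ℝ} (hyR : 15 * y ≤ R)
    (hw : 1 - 3 / 10 * R ≤ ‖w‖)
    (hdist : ∀ v ∈ Metric.closedBall w R, ∀ t ∈ A', 8 * R ≤ ‖circlePt t - v‖)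
    (hout : ∀ v : ℂ, 1 + 2 / 5 * R ≤ ‖v‖ → ‖multTransform Q g (A ∪ A') v‖ ≤ δ) :
    ‖multTransform Q g A' w‖ ^ 4 ≤ (Real.exp B / (4 * R) * ∫ t in A', ‖g t‖) ^ 3 *
      (δ + 5 * Real.exp B / R * ∫ t in A, ‖g t‖) := by
  have hR : 0 < R := by linarith [hQ.type_pos]
  refine norm_pow_four_le hR (fun v hv => ?_) (fun v hv => ?_) fun v _ hwv => ?_
  · exact differentiableAt_multTransform Q hA' hg' (by positivity : 0 < 8 * R) (hdist v hv)
  · exact (hQ.norm_multTransform_le hA' hg' (by linarith) (hdist v hv)).trans_eq (by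
      rw [show 8 * R = 2 * (4 * R) by ring, mul_div_mul_left _ _ two_ne_zero])
  · have hv1 : 1 + 2 / 5 * R ≤ ‖v‖ := by linarith
    have hsub : multTransform Q g A' v = multTransform Q g (A ∪ A') v - multTransform Q g A v := by
      rw [multTransform_union hA hA' hdisj hg hg' (by linarith : 1 < ‖v‖).ne', add_sub_cancel_left]
    have hnear : ‖multTransform Q g A v‖ ≤ 2 * Real.exp B / (2 / 5 * R) * ∫ t in A, ‖g t‖ :=
      hQ.norm_multTransform_le hA hg (by linarith) fun t _ =>
        le_trans (by linarith) (norm_sub_one_le_norm_circlePt_sub v t)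
    rw [hsub]
    refine (norm_sub_le _ _).trans (add_le_add (hout v hv1) (hnear.trans_eq ?_))
    field_simp

theorem HasExpType.norm_multTransform_le_of_small (hQ : HasExpType Q B y) (hA : MeasurableSet A)
    (hA' : MeasurableSet A') (hdisj : Disjoint A A') (hg : IntegrableOn g A)
    (hg' : IntegrableOn g A') {w : ℂ} {R G η : ℝ} (hyR : 15 * y ≤ R) (hR : R ≤ 1 / 5)
    (hw : 1 - 3 / 10 * R ≤ ‖w‖)
    (hdist : ∀ v ∈ Metric.closedBall w R, ∀ t ∈ A', 8 * R ≤ ‖circlePt t - v‖)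
    (hBG : 1 ≤ Real.exp B * G) (hη : 0 ≤ η) (hgA : ∫ t in A, ‖g t‖ ≤ G * η ^ 4)
    (hgA' : ∫ t in A', ‖g t‖ ≤ G)
    (hout : ∀ v : ℂ, 1 + 2 / 5 * R ≤ ‖v‖ → ‖multTransform Q g (A ∪ A') v‖ ≤ η ^ 4) :
    ‖multTransform Q g A' w‖ ≤ 3 / 5 * (Real.exp B * G * η / R) := by
  have hR0 : 0 < R := by linarith [hQ.type_pos]
  have hG : 0 ≤ G := (integral_nonneg fun t => norm_nonneg _).trans hgA'
  have hηR : η ^ 4 ≤ 1 / 5 * (Real.exp B * G * η ^ 4 / R) := by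
    rw [mul_div_assoc', le_div_iff₀ hR0]
    nlinarith [mul_le_mul_of_nonneg_right hBG (pow_nonneg hη 4), pow_nonneg hη 4]
  have hfour := hQ.norm_multTransform_pow_four_le hA hA' hdisj hg hg' hyR hw hdist hout
  refine le_of_pow_le_pow_left₀ four_ne_zero (by positivity) (hfour.trans ?_)
  calc (Real.exp B / (4 * R) * ∫ t in A', ‖g t‖) ^ 3 *
        (η ^ 4 + 5 * Real.exp B / R * ∫ t in A, ‖g t‖)
      ≤ (Real.exp B / (4 * R) * G) ^ 3 *
        (1 / 5 * (Real.exp B * G * η ^ 4 / R) + 5 * Real.exp B / R * (G * η ^ 4)) := by gcongr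
    _ = 13 / 160 * (Real.exp B * G * η / R) ^ 4 := by field_simp; ring
    _ ≤ (3 / 5 * (Real.exp B * G * η / R)) ^ 4 := by
      rw [mul_pow]
      gcongr
      norm_num

variable {S T : Finset ℕ} {ε : ℝ}

theorem norm_one_sub_pos {z : ℂ} (hz : ‖z‖ < 1) : 0 < ‖1 - z‖ :=
  (sub_pos.2 hz).trans_le (by simpa using norm_sub_norm_le 1 z)

theorem IsSparse.norm_multTransform_pushMap_le (hST : IsSparse (S \ T) ε)
    (hQ : IsProdMultiplier S Q) (hA : MeasurableSet A) (hg : IntegrableOn g A) {z : ℂ}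
    (hz : ‖z‖ < 1) :
    ‖multTransform Q g A (pushMap (S \ T) ε z)‖ ≤
      8 * Real.exp (scaleLog (S \ T) T.card ε ‖1 - z‖) / (ε * ‖1 - z‖ ^ 2) * ∫ t in A, ‖g t‖ := by
  have hε := hST.eps_pos
  have hρ := norm_one_sub_pos hz
  have htype := hQ.hasExpType T hε hST.eps_le_one hρ (norm_one_sub_le_two hz.le)
  have hy := htype.type_pos
  refine (htype.norm_multTransform_le hA hg le_rfl fun t _ => ?_).trans ?_
  · linarith [hST.norm_pushMap_le hz.le,
      one_sub_norm_le_norm_circlePt_sub (pushMap (S \ T) ε z) t]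
  · refine mul_le_mul_of_nonneg_right ?_ (integral_nonneg fun t => norm_nonneg _)
    rw [div_le_div_iff₀ (by positivity) (by positivity)]
    nlinarith [le_scaleType (S \ T) ε ‖1 - z‖, Real.exp_pos (scaleLog (S \ T) T.card ε ‖1 - z‖)]

theorem IsSparse.norm_multTransform_Ico_pushMap_le (hST : IsSparse (S \ T) ε)
    (hQ : IsProdMultiplier S Q) (hg : IntegrableOn g (Ioo 0 1)) {r s G η : ℝ} (hr0 : 0 ≤ r)
    (hr1 : r < 1) (hs : 0 < s) (hs1 : s ≤ 1 / 4) (hrs : 100 * (1 - r) ≤ ‖1 - r * circlePt s‖)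
    (hG : 1 ≤ G) (hη : 0 ≤ η) (hgG : ∫ t in Ioo (0 : ℝ) 1, ‖g t‖ ≤ G)
    (hgη : ∫ t in Ioo 0 (2 * s), ‖g t‖ ≤ G * η ^ 4)
    (hout : ∀ v : ℂ, 1 + ‖1 - r * circlePt s‖ / 25 ≤ ‖v‖ →
      ‖multTransform Q g (Ioo 0 1) v‖ ≤ η ^ 4) :
    ‖multTransform Q g (Ico (2 * s) 1) (pushMap (S \ T) ε (r * circlePt s))‖ ≤
      6 * (Real.exp (scaleLog (S \ T) T.card ε ‖1 - r * circlePt s‖) * G * η /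
        ‖1 - r * circlePt s‖) := by
  have hunion : Ioo 0 (2 * s) ∪ Ico (2 * s) 1 = Ioo 0 1 :=
    Ioo_union_Ico_eq_Ioo (by linarith) (by linarith)
  set z : ℂ := r * circlePt s
  have hznorm : ‖z‖ = r := norm_ofReal_mul_circlePt hr0 s
  have hz1 : ‖z‖ ≤ 1 := hznorm.trans_le hr1.le
  have hzs : ‖circlePt s - z‖ = 1 - r := norm_circlePt_sub_ofReal_mul_circlePt hr1.le s
  have hρ2 := norm_one_sub_le_two hz1
  have htype := hQ.hasExpType T hST.eps_pos hST.eps_le_one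
    (norm_one_sub_pos (hznorm.trans_lt hr1)) hρ2
  have hexp : 1 ≤ Real.exp (scaleLog (S \ T) T.card ε ‖1 - z‖) := by
    simpa [hQ.multiplier_eq] using htype.norm_le 0 le_rfl
  have hpush := hST.norm_pushMap_sub_le hz1
  refine (htype.norm_multTransform_le_of_small (R := ‖1 - z‖ / 10) measurableSet_Ioo
    measurableSet_Ico (disjoint_left.2 fun t ht ht' => ht'.1.not_gt ht.2)
    (hg.mono_set (hunion ▸ subset_union_left)) (hg.mono_set (hunion ▸ subset_union_right)) ?_ ?_ ?_
    (fun v hv t ht => ?_) (one_le_mul_of_one_le_of_one_le hexp hG) hη hgη ?_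
    fun v hv => ?_).trans_eq ?_
  · linarith [hST.scaleType_le hz1]
  · linarith
  · linarith [norm_sub_norm_le z (pushMap (S \ T) ε z), norm_sub_rev z (pushMap (S \ T) ε z)]
  · linarith [le_norm_circlePt_sub_of_mem_Ico hs.le hs1 ht (by linarith) hpush
      (mem_closedBall_iff_norm.1 hv)]
  · exact (setIntegral_mono_set hg.norm (Filter.Eventually.of_forall fun t => norm_nonneg _)
      (hunion ▸ subset_union_right).eventuallyLE).trans hgG
  · exact hunion ▸ hout v (by linarith)
  · field_simp
    ring

theorem IsSparse.norm_multTransform_pushMap_le_of_small (hST : IsSparse (S \ T) ε)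
    (hQ : IsProdMultiplier S Q) (hg : IntegrableOn g (Ioo 0 1)) {r s G W η : ℝ} (hr0 : 0 ≤ r)
    (hr1 : r < 1) (hs : 0 < s) (hs1 : s ≤ 1 / 4) (hrs : 100 * (1 - r) ≤ ‖1 - r * circlePt s‖)
    (hG : 1 ≤ G) (hW : 1 ≤ W) (hη : 0 ≤ η) (hηW : η ≤ W) (hgG : ∫ t in Ioo (0 : ℝ) 1, ‖g t‖ ≤ G)
    (hgη : ∫ t in Ioo 0 (2 * s), ‖g t‖ ≤ G * η ^ 4)
    (hout : ∀ v : ℂ, 1 + ‖1 - r * circlePt s‖ / 25 ≤ ‖v‖ →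
      ‖multTransform Q g (Ioo 0 1) v‖ ≤ η ^ 4) :
    ‖multTransform Q g (Ioo 0 1) (pushMap (S \ T) ε (r * circlePt s))‖ ≤
      20 * G * W ^ 3 / (ε * ‖1 - r * circlePt s‖ ^ 2) *
        Real.exp (scaleLog (S \ T) T.card ε ‖1 - r * circlePt s‖) * η := by
  have hfar := hST.norm_multTransform_Ico_pushMap_le hQ hg hr0 hr1 hs hs1 hrs hG hη hgG hgη hout
  have hunion : Ioo 0 (2 * s) ∪ Ico (2 * s) 1 = Ioo 0 1 :=
    Ioo_union_Ico_eq_Ioo (by linarith) (by linarith)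
  have hε := hST.eps_pos
  set z : ℂ := r * circlePt s
  have hz1 : ‖z‖ < 1 := (norm_ofReal_mul_circlePt hr0 s).trans_lt hr1
  set ρ := ‖1 - z‖
  have hρ : 0 < ρ := norm_one_sub_pos hz1
  set E := Real.exp (scaleLog (S \ T) T.card ε ρ)
  have hw1 : ‖pushMap (S \ T) ε z‖ < 1 := by
    linarith [hST.norm_pushMap_le hz1.le, scaleType_pos (U := S \ T) hε hρ]
  have hgnear : IntegrableOn g (Ioo 0 (2 * s)) := hg.mono_set (hunion ▸ subset_union_left)
  have hnear : ‖multTransform Q g (Ioo 0 (2 * s)) (pushMap (S \ T) ε z)‖ ≤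
      8 * G * W ^ 3 / (ε * ρ ^ 2) * E * η := by
    refine (hST.norm_multTransform_pushMap_le hQ measurableSet_Ioo hgnear hz1).trans ?_
    calc 8 * E / (ε * ρ ^ 2) * ∫ t in Ioo 0 (2 * s), ‖g t‖
        ≤ 8 * E / (ε * ρ ^ 2) * (G * (W ^ 3 * η)) := by
          gcongr
          exact hgη.trans (by rw [pow_succ]; gcongr)
      _ = 8 * G * W ^ 3 / (ε * ρ ^ 2) * E * η := by ring
  have hscale : 1 ≤ W ^ 3 * (2 / (ε * ρ)) := by
    refine one_le_mul_of_one_le_of_one_le (one_le_pow₀ hW) ((one_le_div (by positivity)).2 ?_)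
    nlinarith [hST.eps_le_one, norm_one_sub_le_two hz1.le]
  have hfar' : 6 * (E * G * η / ρ) ≤ 12 * G * W ^ 3 / (ε * ρ ^ 2) * E * η :=
    calc 6 * (E * G * η / ρ) ≤ 6 * (E * G * η / ρ) * (W ^ 3 * (2 / (ε * ρ))) :=
          le_mul_of_one_le_right (by positivity) hscale
      _ = 12 * G * W ^ 3 / (ε * ρ ^ 2) * E * η := by field_simp; ring
  rw [← hunion, multTransform_union measurableSet_Ioo measurableSet_Ico
    (disjoint_left.2 fun t ht ht' => ht'.1.not_gt ht.2) hgnear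
    (hg.mono_set (hunion ▸ subset_union_right)) hw1.ne]
  calc _ ≤ 8 * G * W ^ 3 / (ε * ρ ^ 2) * E * η + 12 * G * W ^ 3 / (ε * ρ ^ 2) * E * η :=
        (norm_add_le _ _).trans (add_le_add hnear (hfar.trans hfar'))
    _ = 20 * G * W ^ 3 / (ε * ρ ^ 2) * E * η := by ring

end

/-! ### The logarithmic majorant -/

theorem log_div_mul_sq {a e t : ℝ} (ha : 0 < a) (he : 0 < e) (ht : t ≠ 0) :
    Real.log (a / (e * t ^ 2)) = Real.log (a / e) - 2 * Real.log t := by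
  rw [← div_div, Real.log_div (by positivity) (by positivity), Real.log_pow, Nat.cast_ofNat]

theorem intervalIntegrable_const_sub_mul_log (a b c k : ℝ) :
    IntervalIntegrable (fun t => k - c * Real.log t) volume a b :=
  intervalIntegrable_const.sub (intervalIntegral.intervalIntegrable_log'.const_mul c)

theorem intervalIntegrable_log_div_mul_sq {a e : ℝ} (ha : 0 < a) (he : 0 < e) :
    IntervalIntegrable (fun t => Real.log (a / (e * t ^ 2))) volume 0 1 :=
  (intervalIntegrable_const_sub_mul_log 0 1 2 (Real.log (a / e))).congr fun _ ht =>
    (log_div_mul_sq ha he (uIoc_of_le (zero_le_one' ℝ) ▸ ht).1.ne').symm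

theorem integral_log_div_mul_sq {a e : ℝ} (ha : 0 < a) (he : 0 < e) :
    ∫ t in (0 : ℝ)..1, Real.log (a / (e * t ^ 2)) = Real.log (a / e) + 2 := by
  have hlog : ∀ t ∈ uIoc (0 : ℝ) 1,
      Real.log (a / (e * t ^ 2)) = Real.log (a / e) - 2 * Real.log t := fun t ht =>
    log_div_mul_sq ha he (uIoc_of_le (zero_le_one' ℝ) ▸ ht).1.ne'
  rw [intervalIntegral.integral_congr_ae (.of_forall hlog), intervalIntegral.integral_sub
    intervalIntegrable_const (intervalIntegral.intervalIntegrable_log'.const_mul 2),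
    intervalIntegral.integral_const_mul, integral_log]
  simp

theorem posLog_div_eq_log_sub {c t : ℝ} (ht : t ∈ Ioc 0 c) :
    posLog (c / t) = Real.log c - Real.log t := by
  have hc : 0 < c := ht.1.trans_le ht.2
  rw [Real.posLog_eq_log, Real.log_div hc.ne' ht.1.ne']
  rw [abs_of_pos (div_pos hc ht.1)]
  exact (one_le_div ht.1).2 ht.2

theorem posLog_div_eq_zero {c t : ℝ} (hc : 0 < c) (ht : c < t) : posLog (c / t) = 0 := by
  rw [Real.posLog_eq_zero_iff, abs_of_pos (div_pos hc (hc.trans ht))]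
  exact div_le_one_of_le₀ ht.le (hc.trans ht).le

section

variable {c : ℝ}

theorem intervalIntegrable_posLog_div_left (hc0 : 0 < c) :
    IntervalIntegrable (fun t => posLog (c / t)) volume 0 c :=
  (intervalIntegrable_const.sub intervalIntegral.intervalIntegrable_log').congr fun _ ht =>
    (posLog_div_eq_log_sub (uIoc_of_le hc0.le ▸ ht)).symm

theorem intervalIntegrable_posLog_div_right (hc0 : 0 < c) (hc1 : c ≤ 1) :
    IntervalIntegrable (fun t => posLog (c / t)) volume c 1 :=
  (intervalIntegrable_const (c := (0 : ℝ))).congr fun _ ht =>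
    (posLog_div_eq_zero hc0 (uIoc_of_le hc1 ▸ ht).1).symm

theorem intervalIntegrable_posLog_div (hc0 : 0 < c) (hc1 : c ≤ 1) :
    IntervalIntegrable (fun t => posLog (c / t)) volume 0 1 :=
  (intervalIntegrable_posLog_div_left hc0).trans (intervalIntegrable_posLog_div_right hc0 hc1)

theorem integral_posLog_div (hc0 : 0 < c) (hc1 : c ≤ 1) :
    ∫ t in (0 : ℝ)..1, posLog (c / t) = c := by
  have hleft : ∫ t in 0..c, posLog (c / t) = ∫ t in 0..c, (Real.log c - Real.log t) :=
    intervalIntegral.integral_congr_ae (.of_forall fun _ ht =>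
      posLog_div_eq_log_sub (uIoc_of_le hc0.le ▸ ht))
  have hright : ∫ t in c..1, posLog (c / t) = ∫ _ in c..1, 0 :=
    intervalIntegral.integral_congr_ae (.of_forall fun _ ht =>
      posLog_div_eq_zero hc0 (uIoc_of_le hc1 ▸ ht).1)
  rw [← intervalIntegral.integral_add_adjacent_intervals (intervalIntegrable_posLog_div_left hc0)
    (intervalIntegrable_posLog_div_right hc0 hc1), hleft, hright, intervalIntegral.integral_sub
    intervalIntegrable_const intervalIntegral.intervalIntegrable_log', integral_log]
  simp

end

theorem posLog_one_div_mul_sq {x : ℝ} (hx : 0 ≤ x) (t : ℝ) :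
    posLog (1 / (x * t ^ 2)) = 2 * posLog (1 / √x / t) := by
  rw [← Nat.cast_ofNat (R := ℝ), ← Real.posLog_pow, div_pow, div_pow, Real.sq_sqrt hx, one_pow,
    div_div]

/-- The logarithm of a bound `a / (ε ρ²) * exp (scaleLog U m ε ρ)` for the transform at distance `ρ`
from `1`. -/
noncomputable def logMajorant (U : Finset ℕ) (m : ℕ) (ε a ρ : ℝ) : ℝ :=
  scaleLog U m ε ρ + Real.log (a / (ε * ρ ^ 2))

section

variable {U : Finset ℕ} {m : ℕ} {ε a ρ : ℝ}

theorem logMajorant_eq_log (hε : 0 < ε) (ha : 0 < a) (hρ : 0 < ρ) :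
    logMajorant U m ε a ρ = Real.log (a / (ε * ρ ^ 2) * Real.exp (scaleLog U m ε ρ)) := by
  rw [logMajorant, Real.log_mul (by positivity) (Real.exp_pos _).ne', Real.log_exp, add_comm]

theorem antitoneOn_logMajorant (hU : ∀ γ ∈ U, 1 ≤ γ) (hε : 0 < ε) (ha : 0 < a) :
    AntitoneOn (logMajorant U m ε a) (Ioi 0) := by
  intro ρ (hρ : 0 < ρ) ρ' (hρ' : 0 < ρ') h
  have hposLog : ∀ γ ∈ U, posLog (1 / ((γ : ℝ) * ρ' ^ 2)) ≤ posLog (1 / (γ * ρ ^ 2)) := by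
    intro γ hγ
    have hγ0 : (0 : ℝ) < γ := Nat.cast_pos.2 (hU γ hγ)
    exact Real.posLog_le_posLog (by positivity) (by gcongr)
  have hlog : ∀ b : ℝ, 0 < b → Real.log (b / (ε * ρ' ^ 2)) ≤ Real.log (b / (ε * ρ ^ 2)) :=
    fun b hb => Real.log_le_log (by positivity) (by gcongr)
  exact add_le_add (add_le_add (Finset.sum_le_sum hposLog)
    (mul_le_mul_of_nonneg_left (hlog _ (by positivity)) (Nat.cast_nonneg m))) (hlog a ha)

theorem logMajorant_nonneg (hε : 0 < ε) (hε1 : ε ≤ 1) (ha : 1 ≤ a) (hρ : 0 < ρ) (hρ1 : ρ ≤ 1) :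
    0 ≤ logMajorant U m ε a ρ := by
  have hle : ε * ρ ^ 2 ≤ 1 := mul_le_one₀ hε1 (by positivity) (pow_le_one₀ hρ.le hρ1)
  have hlog : ∀ b : ℝ, 1 ≤ b → 0 ≤ Real.log (b / (ε * ρ ^ 2)) := fun b hb =>
    Real.log_nonneg ((one_le_div (by positivity)).2 (hle.trans hb))
  exact add_nonneg (add_nonneg (Finset.sum_nonneg fun γ _ => Real.posLog_nonneg)
    (mul_nonneg m.cast_nonneg (hlog _ (by linarith [m.cast_nonneg (α := ℝ)])))) (hlog a ha)

theorem intervalIntegrable_posLog_one_div_mul_sq {γ : ℕ} (hγ : 1 ≤ γ) :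
    IntervalIntegrable (fun t => posLog (1 / (γ * t ^ 2))) volume 0 1 := by
  have hsqrt : 1 ≤ √(γ : ℝ) := Real.one_le_sqrt.2 (Nat.one_le_cast.2 hγ)
  have hint := intervalIntegrable_posLog_div (c := 1 / √(γ : ℝ)) (by positivity)
    (div_le_one_of_le₀ hsqrt (by positivity))
  simpa only [posLog_one_div_mul_sq γ.cast_nonneg] using hint.const_mul 2

theorem integral_posLog_one_div_mul_sq {γ : ℕ} (hγ : 1 ≤ γ) :
    ∫ t in (0 : ℝ)..1, posLog (1 / (γ * t ^ 2)) = 2 * (1 / √(γ : ℝ)) := by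
  have hsqrt : 1 ≤ √(γ : ℝ) := Real.one_le_sqrt.2 (Nat.one_le_cast.2 hγ)
  simp only [posLog_one_div_mul_sq γ.cast_nonneg, intervalIntegral.integral_const_mul]
  rw [integral_posLog_div (by positivity) (div_le_one_of_le₀ hsqrt (by positivity))]

theorem intervalIntegrable_scaleLog (hU : ∀ γ ∈ U, 1 ≤ γ) (hε : 0 < ε) :
    IntervalIntegrable (scaleLog U m ε) volume 0 1 := by
  have hsum := IntervalIntegrable.sum U fun γ hγ =>
    intervalIntegrable_posLog_one_div_mul_sq (hU γ hγ)
  refine (hsum.add ((intervalIntegrable_log_div_mul_sq (a := 24 * (m + 1)) (by positivity)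
    hε).const_mul m)).congr fun t _ => ?_
  simp only [scaleLog, Finset.sum_apply]

theorem integral_scaleLog (hU : ∀ γ ∈ U, 1 ≤ γ) (hε : 0 < ε) :
    ∫ t in (0 : ℝ)..1, scaleLog U m ε t =
      2 * ∑ γ ∈ U, 1 / √(γ : ℝ) + m * (Real.log (24 * (m + 1) / ε) + 2) := by
  have hint : ∀ γ ∈ U, IntervalIntegrable (fun t => posLog (1 / ((γ : ℝ) * t ^ 2))) volume 0 1 :=
    fun γ hγ => intervalIntegrable_posLog_one_div_mul_sq (hU γ hγ)
  have hlog : (0 : ℝ) < 24 * (m + 1) := by positivity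
  unfold scaleLog
  rw [intervalIntegral.integral_add _ ((intervalIntegrable_log_div_mul_sq hlog hε).const_mul m),
    intervalIntegral.integral_const_mul, integral_log_div_mul_sq hlog hε,
    intervalIntegral.integral_finsetSum hint, Finset.mul_sum,
    Finset.sum_congr rfl fun γ hγ => integral_posLog_one_div_mul_sq (hU γ hγ)]
  exact (IntervalIntegrable.sum U hint).congr fun t _ => by simp

theorem intervalIntegrable_logMajorant (hU : ∀ γ ∈ U, 1 ≤ γ) (hε : 0 < ε) (ha : 0 < a) :
    IntervalIntegrable (logMajorant U m ε a) volume 0 1 :=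
  (intervalIntegrable_scaleLog hU hε).add (intervalIntegrable_log_div_mul_sq ha hε)

theorem integral_logMajorant (hU : ∀ γ ∈ U, 1 ≤ γ) (hε : 0 < ε) (ha : 0 < a) :
    ∫ t in (0 : ℝ)..1, logMajorant U m ε a t = 2 * ∑ γ ∈ U, 1 / √(γ : ℝ) +
      m * (Real.log (24 * (m + 1) / ε) + 2) + (Real.log (a / ε) + 2) := by
  unfold logMajorant
  rw [intervalIntegral.integral_add (intervalIntegrable_scaleLog hU hε)
    (intervalIntegrable_log_div_mul_sq ha hε), integral_scaleLog hU hε,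
    integral_log_div_mul_sq ha hε]

theorem scaleType_le_self (hε1 : ε ≤ 1) (hsum : ∑ γ ∈ U, 1 / √(γ : ℝ) ≤ 1 / 2) (hρ : 0 ≤ ρ)
    (hρ1 : ρ ≤ 1) : scaleType U ε ρ ≤ ρ := by
  have hmin : ∑ γ ∈ U, min (ρ ^ 2) (1 / (γ : ℝ)) ≤ ρ * ∑ γ ∈ U, 1 / √(γ : ℝ) := by
    rw [Finset.mul_sum]
    refine Finset.sum_le_sum fun γ _ => ?_
    rw [← Real.sq_sqrt γ.cast_nonneg, ← one_div_pow, Real.sqrt_sq (Real.sqrt_nonneg _)]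
    rcases le_total ρ (1 / √(γ : ℝ)) with h | h
    · exact (min_le_left _ _).trans (by rw [sq]; gcongr)
    · exact (min_le_right _ _).trans (by rw [sq]; gcongr)
  unfold scaleType
  nlinarith [mul_le_mul_of_nonneg_right hε1 (sq_nonneg ρ)]

theorem scaleLog_le (hsum : ∑ γ ∈ U, 1 / √(γ : ℝ) ≤ 1 / 2) (hρ : 0 < ρ) :
    scaleLog U m ε ρ ≤ 1 / ρ + m * Real.log (24 * (m + 1) / (ε * ρ ^ 2)) := by
  have hposLog : ∀ x : ℝ, 0 ≤ x → posLog x ≤ x := fun x hx => max_le hx (Real.log_le_self hx)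
  unfold scaleLog
  gcongr
  calc ∑ γ ∈ U, posLog (1 / ((γ : ℝ) * ρ ^ 2)) ≤ ∑ γ ∈ U, 2 * (1 / √(γ : ℝ) / ρ) :=
        Finset.sum_le_sum fun γ _ => by
          rw [posLog_one_div_mul_sq γ.cast_nonneg]
          gcongr
          exact hposLog _ (by positivity)
    _ = 2 / ρ * ∑ γ ∈ U, 1 / √(γ : ℝ) := by
        rw [Finset.mul_sum]
        exact Finset.sum_congr rfl fun γ _ => by ring
    _ ≤ 2 / ρ * (1 / 2) := by gcongr
    _ = 1 / ρ := by ring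

end

/-! ### Truncations of the set of missing frequencies -/

section

variable {Γ : Set ℕ} {T : Finset ℕ}

theorem exists_finset_sum_le (hsum : Summable fun γ : Γ => 1 / √((γ : ℕ) : ℝ)) {e : ℝ}
    (he : 0 < e) :
    ∃ T : Finset ℕ, ∀ S : Finset ℕ, (S : Set ℕ) ⊆ Γ → ∑ γ ∈ S \ T, 1 / √(γ : ℝ) ≤ e := by
  obtain ⟨T, hT⟩ := summable_iff_vanishing_norm.1
    ((summable_subtype_iff_indicator (f := fun n : ℕ => 1 / √(n : ℝ))).1 hsum) e he
  refine ⟨T, fun S hS => ?_⟩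
  calc ∑ γ ∈ S \ T, 1 / √(γ : ℝ)
      = ∑ γ ∈ S \ T, Γ.indicator (fun n : ℕ => 1 / √(n : ℝ)) γ := Finset.sum_congr rfl fun γ hγ =>
        (indicator_of_mem (hS (Finset.mem_sdiff.1 hγ).1) (fun n : ℕ => 1 / √(n : ℝ))).symm
    _ ≤ e := (le_abs_self _).trans (hT (S \ T) Finset.sdiff_disjoint).le

theorem exists_norm_prod_one_add_div_le (T : Finset ℕ) {α : ℝ} (hα : 0 < α) :
    ∃ C, 0 ≤ C ∧ ∀ S : Finset ℕ, (∀ γ ∈ S, 1 ≤ γ) → ∑ γ ∈ S \ T, 1 / √(γ : ℝ) ≤ 1 / 2 →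
      ∀ x : ℂ, ‖∏ γ ∈ S, (1 + x / (γ : ℂ))‖ ≤ C * Real.exp (α * ‖x‖) := by
  set ρ := min 1 α
  have hρ : 0 < ρ := lt_min one_pos hα
  have hρ1 : ρ ≤ 1 := min_le_left _ _
  refine ⟨Real.exp (1 / ρ + T.card * Real.log (24 * (T.card + 1) / (1 * ρ ^ 2))),
    (Real.exp_pos _).le, fun S hS hsum x => ?_⟩
  refine (norm_prod_one_add_div_le hS T one_pos le_rfl hρ (by linarith) x).trans ?_
  rw [← Real.exp_add]
  gcongr
  · exact scaleLog_le hsum hρ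
  · exact (scaleType_le_self le_rfl hsum hρ.le hρ1).trans (min_le_right _ _)

theorem prod_one_add_neg_div_eq_zero {S : Finset ℕ} {n : ℕ} (hn : n + 1 ∈ S) :
    ∏ γ ∈ S, (1 + -((n : ℂ) + 1) / γ) = 0 := by
  refine Finset.prod_eq_zero hn ?_
  rw [Nat.cast_add_one, neg_div, div_self (Nat.cast_add_one_ne_zero n), add_neg_cancel]

theorem exists_norm_multTransform_le
    (hT : ∀ S : Finset ℕ, (S : Set ℕ) ⊆ Γ → ∑ γ ∈ S \ T, 1 / √(γ : ℝ) ≤ 1 / 2) {g : ℝ → ℂ}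
    {A : Set ℝ} (hg : IntegrableOn g A)
    (hspec : ∀ n ∈ Ici 1 \ Γ, ∫ t in A, g t * circlePt t ^ n = 0) {l δ : ℝ} (hl : 0 < l)
    (hδ : 0 < δ) :
    ∃ S : Finset ℕ, (S : Set ℕ) ⊆ Γ ∧ ∀ Q : ℝ[X], IsProdMultiplier S Q →
      ∀ v : ℂ, 1 + l ≤ ‖v‖ → ‖multTransform Q g A v‖ ≤ δ := by
  classical
  set q := 1 + l / 2 with hq
  set ϑ := q / (1 + l) with hϑ
  have hϑ0 : 0 ≤ ϑ := by positivity
  have hϑ1 : ϑ < 1 := (div_lt_one (by linarith)).2 (by linarith)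
  obtain ⟨C, hC, hgrowth⟩ :=
    exists_norm_prod_one_add_div_le T (Real.log_pos (by linarith : 1 < q))
  have hlim : Filter.Tendsto (fun N : ℕ => C * (∫ t in A, ‖g t‖) * ϑ ^ N * (1 - ϑ)⁻¹)
      Filter.atTop (nhds 0) := by
    simpa using ((tendsto_pow_atTop_nhds_zero_of_lt_one hϑ0 hϑ1).const_mul
      (C * ∫ t in A, ‖g t‖)).mul_const (1 - ϑ)⁻¹
  obtain ⟨N, hN⟩ := (hlim.eventually (gt_mem_nhds hδ)).exists
  have hSΓ : (((Finset.Icc 1 N).filter (· ∈ Γ) : Finset ℕ) : Set ℕ) ⊆ Γ := fun γ hγ =>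
    (Finset.mem_filter.1 hγ).2
  refine ⟨_, hSΓ, fun Q hQ v hv => (norm_multTransform_le_of_forall_lt (q := q) hg hC
    hϑ0 hϑ1 (by linarith) ?_ (by positivity) (fun n => ?_) fun n hn => ?_).trans hN.le⟩
  · rw [hϑ, div_mul_eq_mul_div, le_div_iff₀ (by positivity)]
    gcongr
  · have hbound := hgrowth _ hQ.one_le (hT _ hSΓ) (-((n : ℂ) + 1))
    have hnorm : ‖-((n : ℂ) + 1)‖ = ((n + 1 : ℕ) : ℝ) := by
      rw [norm_neg, ← Nat.cast_add_one, Complex.norm_natCast]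
    rwa [← hQ.multiplier_eq, hnorm, mul_comm (Real.log q), Real.exp_nat_mul,
      Real.exp_log (by positivity)] at hbound
  · by_cases hn1 : n + 1 ∈ Γ
    · left
      rw [hQ.multiplier_eq]
      exact prod_one_add_neg_div_eq_zero
        (Finset.mem_filter.2 ⟨Finset.mem_Icc.2 ⟨by omega, hn⟩, hn1⟩)
    · exact Or.inr (hspec _ ⟨Nat.le_add_left 1 n, hn1⟩)

end

/-! ### Weights with a deep zero -/

section

variable {w : ℝ → ℝ}

theorem IsDeepZeroWeight.sqrt (hw : IsDeepZeroWeight w) : IsDeepZeroWeight fun t => √(w t) where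
  pos t ht := Real.sqrt_pos.2 (hw.pos t ht)
  mono _ hx _ hy hxy := Real.sqrt_le_sqrt (hw.mono hx hy hxy)
  bdd := hw.bdd.imp' (fun M => √M) fun _ hM t ht => Real.sqrt_le_sqrt (hM t ht)
  log_int := by
    have hhalf : ∀ f : ℝ → ℝ, ∫⁻ t in Ioo (0 : ℝ) 1, ENNReal.ofReal (1 / 2 * f t) =
        ENNReal.ofReal (1 / 2) * ∫⁻ t in Ioo (0 : ℝ) 1, ENNReal.ofReal (f t) := fun f => by
      simp only [ENNReal.ofReal_mul (by norm_num : (0 : ℝ) ≤ 1 / 2)]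
      exact lintegral_const_mul' _ _ ENNReal.ofReal_ne_top
    have hlog : ∀ t ∈ Ioo (0 : ℝ) 1, Real.log √(w t) = 1 / 2 * Real.log (w t) := fun t ht => by
      rw [Real.log_sqrt (hw.pos t ht).le]
      ring
    constructor
    · rw [setLIntegral_congr_fun measurableSet_Ioo fun t ht => by rw [hlog t ht], hhalf]
      exact ENNReal.mul_lt_top ENNReal.ofReal_lt_top hw.log_int.1
    · rw [setLIntegral_congr_fun measurableSet_Ioo fun t ht => by rw [hlog t ht, ← mul_neg],
        hhalf, hw.log_int.2]
      exact ENNReal.mul_top (by norm_num)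

theorem IsDeepZeroWeight.monotoneOn_log (hw : IsDeepZeroWeight w) :
    MonotoneOn (fun t => Real.log (w t)) (Ioo 0 1) := fun x hx _ hy hxy =>
  Real.log_le_log (hw.pos x hx) (hw.mono hx hy hxy)

theorem IsDeepZeroWeight.integrableOn_log (hw : IsDeepZeroWeight w) {a b : ℝ} (ha : 0 < a)
    (hb : b < 1) : IntegrableOn (fun t => Real.log (w t)) (Icc a b) :=
  (hw.monotoneOn_log.mono fun _ ht => ⟨ha.trans_le ht.1, ht.2.trans_lt hb⟩).integrableOn_isCompact
    isCompact_Icc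

theorem IsDeepZeroWeight.exists_log_le (hw : IsDeepZeroWeight w) :
    ∃ K, 0 ≤ K ∧ ∀ t ∈ Ioo (0 : ℝ) 1, Real.log (w t) ≤ K := by
  obtain ⟨M, hM⟩ := hw.bdd
  exact ⟨|Real.log M|, abs_nonneg _, fun t ht =>
    (Real.log_le_log (hw.pos t ht) (hM t ht)).trans (le_abs_self _)⟩

theorem IsDeepZeroWeight.not_integrableOn_log (hw : IsDeepZeroWeight w) :
    ¬ IntegrableOn (fun t => Real.log (w t)) (Ioc 0 (1 / 2)) := by
  intro hleft
  obtain ⟨K, -, hK⟩ := hw.exists_log_le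
  have hright : IntegrableOn (fun t => Real.log (w t)) (Ioo (1 / 2) 1) := by
    have hsub : Ioo (1 / 2 : ℝ) 1 ⊆ Ioo 0 1 := Ioo_subset_Ioo_left (by norm_num)
    have hconst : IntegrableOn (fun _ => max |Real.log (w (1 / 2))| |K|) (Ioo (1 / 2 : ℝ) 1) :=
      integrableOn_const (by simp)
    refine hconst.mono' (aemeasurable_restrict_of_monotoneOn measurableSet_Ioo
      (hw.monotoneOn_log.mono hsub)).aestronglyMeasurable ?_
    filter_upwards [ae_restrict_mem measurableSet_Ioo] with t ht
    exact abs_le_max_abs_abs (hw.monotoneOn_log (by norm_num) (hsub ht) ht.1.le) (hK t (hsub ht))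
  have hint : IntegrableOn (fun t => Real.log (w t)) (Ioo 0 1) :=
    Ioc_union_Ioo_eq_Ioo (by norm_num : (0 : ℝ) ≤ 1 / 2) (by norm_num : (1 / 2 : ℝ) < 1) ▸
      hleft.union hright
  exact (hint.neg.lintegral_lt_top).ne hw.log_int.2

theorem IsDeepZeroWeight.exists_integral_log_lt (hw : IsDeepZeroWeight w) (C : ℝ) :
    ∃ τ ∈ Ioo (0 : ℝ) (1 / 4), ∫ t in τ..(1 / 4), Real.log (w (2 * t)) < C := by
  by_contra! hC
  obtain ⟨K, hK0, hK⟩ := hw.exists_log_le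
  have htail : ∀ a ∈ Ioo (0 : ℝ) (1 / 2), ∫ t in Ioc a (1 / 2), ‖Real.log (w t)‖ ≤
      2 * K - 2 * C := by
    intro a ha
    have hhalf := hC (a / 2) ⟨half_pos ha.1, by linarith [ha.2]⟩
    rw [intervalIntegral.integral_comp_mul_left (fun t => Real.log (w t)) two_ne_zero,
      mul_div_cancel₀ a two_ne_zero, show (2 : ℝ) * (1 / 4) = 1 / 2 by norm_num,
      intervalIntegral.integral_of_le ha.2.le, smul_eq_mul] at hhalf
    have hint : IntegrableOn (fun t => Real.log (w t)) (Ioc a (1 / 2)) :=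
      (hw.integrableOn_log ha.1 (by norm_num)).mono_set Ioc_subset_Icc_self
    have hconst : IntegrableOn (fun _ => 2 * K) (Ioc a (1 / 2)) := integrableOn_const (by simp)
    calc ∫ t in Ioc a (1 / 2), ‖Real.log (w t)‖
        ≤ ∫ t in Ioc a (1 / 2), (2 * K - Real.log (w t)) :=
          setIntegral_mono_on hint.norm (hconst.sub hint) measurableSet_Ioc fun t ht => by
            have hle := hK t ⟨ha.1.trans ht.1, ht.2.trans_lt (by norm_num)⟩
            exact abs_le.2 ⟨by linarith, by linarith⟩
      _ = (1 / 2 - a) * (2 * K) - ∫ t in Ioc a (1 / 2), Real.log (w t) := by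
          rw [integral_sub hconst hint, setIntegral_const, Real.volume_real_Ioc_of_le ha.2.le,
            smul_eq_mul]
      _ ≤ 2 * K - 2 * C := by nlinarith [mul_nonneg ha.1.le hK0]
  refine hw.not_integrableOn_log (integrableOn_Ioc_of_intervalIntegral_norm_bounded_left
    (a := fun n : ℕ => 1 / ((n : ℝ) + 3)) (l := Filter.atTop) (I := 2 * K - 2 * C) (fun n => ?_) ?_
    (.of_forall fun n => htail _ ⟨by positivity, ?_⟩))
  · exact (hw.integrableOn_log (by positivity) (by norm_num)).mono_set Ioc_subset_Icc_self
  · exact_mod_cast (tendsto_const_div_atTop_nhds_zero_nat (1 : ℝ)).comp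
      (Filter.tendsto_add_atTop_nat 3)
  · exact one_div_lt_one_div_of_lt two_pos (by linarith [n.cast_nonneg (α := ℝ)])

end

/-- `g` vanishes deeply at the origin from the right: its integral over `(0, s)` is controlled by a
weight with a deep zero. Only the size of `g` matters, so the condition is unaffected by unimodular
factors and conjugation. -/
structure HasDeepZero (g : ℝ → ℂ) : Prop where
  integrableOn : IntegrableOn g (Ioo 0 1)
  exists_weight : ∃ w, IsDeepZeroWeight w ∧
    ∃ G, ∀ s ∈ Ioo (0 : ℝ) 1, ∫ t in Ioo 0 s, ‖g t‖ ≤ G * w s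

section

variable {g : ℝ → ℂ}

theorem hasDeepZero_of_le_mul (hg : AEStronglyMeasurable g (volume.restrict (Ioo 0 1)))
    {w q : ℝ → ℝ} (hw : IsDeepZeroWeight w) (hq : IntegrableOn q (Ioo 0 1))
    (hgq : ∀ᵐ t ∂volume.restrict (Ioo (0 : ℝ) 1), ‖g t‖ ≤ w t * ‖q t‖) : HasDeepZero g := by
  obtain ⟨M, hM⟩ := hw.bdd
  have hint : IntegrableOn g (Ioo 0 1) := by
    refine (hq.norm.const_mul M).mono' hg ?_
    filter_upwards [hgq, ae_restrict_mem measurableSet_Ioo] with t ht ht'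
    exact ht.trans (mul_le_mul_of_nonneg_right (hM t ht') (norm_nonneg _))
  refine ⟨hint, w, hw, ∫ t in Ioo (0 : ℝ) 1, ‖q t‖, fun s hs => ?_⟩
  have hsub : Ioo 0 s ⊆ Ioo (0 : ℝ) 1 := Ioo_subset_Ioo_right hs.2.le
  calc ∫ t in Ioo 0 s, ‖g t‖ ≤ ∫ t in Ioo 0 s, ‖q t‖ * w s := by
        refine setIntegral_mono_ae_restrict (hint.mono_set hsub).norm
          ((hq.mono_set hsub).norm.mul_const _) ?_
        filter_upwards [ae_restrict_mem measurableSet_Ioo,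
          ae_mono (Measure.restrict_mono hsub le_rfl) hgq] with t ht hgt
        rw [mul_comm]
        exact hgt.trans
          (mul_le_mul_of_nonneg_right (hw.mono (hsub ht) hs ht.2.le) (norm_nonneg _))
    _ = (∫ t in Ioo 0 s, ‖q t‖) * w s := integral_mul_const _ _
    _ ≤ (∫ t in Ioo (0 : ℝ) 1, ‖q t‖) * w s := mul_le_mul_of_nonneg_right
        (setIntegral_mono_set hq.norm (.of_forall fun _ => norm_nonneg _) hsub.eventuallyLE)
        (hw.pos s hs).le

theorem HasDeepZero.of_norm_eq {g' : ℝ → ℂ} (hg : HasDeepZero g)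
    (hg' : AEStronglyMeasurable g' (volume.restrict (Ioo 0 1))) (h : ∀ t, ‖g' t‖ = ‖g t‖) :
    HasDeepZero g' where
  integrableOn := hg.integrableOn.congr' hg' (.of_forall fun t => (h t).symm)
  exists_weight := by simpa only [h] using hg.exists_weight

theorem HasDeepZero.exists_fourth_root (hg : HasDeepZero g) :
    ∃ η, IsDeepZeroWeight η ∧ ∃ G, 1 ≤ G ∧ ∫ t in Ioo (0 : ℝ) 1, ‖g t‖ ≤ G ∧
      ∀ s ∈ Ioo (0 : ℝ) 1, ∫ t in Ioo 0 s, ‖g t‖ ≤ G * η s ^ 4 := by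
  obtain ⟨w, hw, G, hG⟩ := hg.exists_weight
  refine ⟨_, hw.sqrt.sqrt, max 1 (max (∫ t in Ioo (0 : ℝ) 1, ‖g t‖) G), le_max_left _ _,
    (le_max_left _ _).trans (le_max_right _ _), fun s hs => ?_⟩
  have hroot : √√(w s) ^ 4 = w s := by
    rw [pow_mul _ 2 2, Real.sq_sqrt (Real.sqrt_nonneg _), Real.sq_sqrt (hw.pos s hs).le]
  rw [hroot]
  exact (hG s hs).trans (mul_le_mul_of_nonneg_right ((le_max_right _ _).trans (le_max_right _ _))
    (hw.pos s hs).le)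

end

/-! ### Vanishing of the mean -/

section

variable {S T : Finset ℕ} {Q : ℝ[X]} {g : ℝ → ℂ} {ε a : ℝ}

theorem logMajorant_le_add {U : Finset ℕ} {m : ℕ} (hU : ∀ γ ∈ U, 1 ≤ γ) (hε : 0 < ε) (hε1 : ε ≤ 1)
    (ha : 1 ≤ a) {t ρ : ℝ} (ht : t ∈ Ioo (0 : ℝ) 1) (hρ : min t (1 - t) ≤ ρ) :
    logMajorant U m ε a ρ ≤ logMajorant U m ε a t + logMajorant U m ε a (1 - t) := by
  have ht' : 0 < 1 - t := sub_pos.2 ht.2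
  have hmin : 0 < min t (1 - t) := lt_min ht.1 ht'
  have hanti := antitoneOn_logMajorant (m := m) hU hε (zero_lt_one.trans_le ha) hmin
    (hmin.trans_le hρ) hρ
  have h₁ := logMajorant_nonneg (U := U) (m := m) hε hε1 ha ht.1 ht.2.le
  have h₂ := logMajorant_nonneg (U := U) (m := m) hε hε1 ha ht' (by linarith [ht.1])
  rcases min_choice t (1 - t) with h | h <;> rw [h] at hanti <;> linarith

theorem IsSparse.differentiableOn_multTransform_pushMap {U : Finset ℕ} (hU : IsSparse U ε)
    (Q : ℝ[X]) {A : Set ℝ} (hA : MeasurableSet A) (hg : IntegrableOn g A) :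
    DifferentiableOn ℂ (fun z => multTransform Q g A (pushMap U ε z)) (Metric.ball 0 1) := by
  refine (differentiableOn_multTransform Q hA hg).comp (differentiableOn_pushMap hU.one_le)
    fun z hz => ?_
  rw [mem_ball_zero_iff] at hz ⊢
  linarith [hU.norm_pushMap_le hz.le, scaleType_pos (U := U) hU.eps_pos (norm_one_sub_pos hz)]

theorem IsSparse.log_norm_multTransform_pushMap_le (hST : IsSparse (S \ T) ε)
    (hQ : IsProdMultiplier S Q) {A : Set ℝ} (hA : MeasurableSet A) (hg : IntegrableOn g A)
    (ha : 0 < a) (hga : 8 * ∫ t in A, ‖g t‖ ≤ a) {z : ℂ} (hz : ‖z‖ < 1)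
    (hne : multTransform Q g A (pushMap (S \ T) ε z) ≠ 0) :
    Real.log ‖multTransform Q g A (pushMap (S \ T) ε z)‖ ≤
      logMajorant (S \ T) T.card ε a ‖1 - z‖ := by
  have hε := hST.eps_pos
  rw [logMajorant_eq_log hε ha (norm_one_sub_pos hz)]
  refine Real.log_le_log (norm_pos_iff.2 hne)
    ((hST.norm_multTransform_pushMap_le hQ hA hg hz).trans ?_)
  calc 8 * Real.exp (scaleLog (S \ T) T.card ε ‖1 - z‖) / (ε * ‖1 - z‖ ^ 2) * ∫ t in A, ‖g t‖
      = 8 * (∫ t in A, ‖g t‖) / (ε * ‖1 - z‖ ^ 2) *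
          Real.exp (scaleLog (S \ T) T.card ε ‖1 - z‖) := by ring
    _ ≤ a / (ε * ‖1 - z‖ ^ 2) * Real.exp (scaleLog (S \ T) T.card ε ‖1 - z‖) := by gcongr

theorem IsSparse.log_norm_multTransform_pushMap_le_of_small (hST : IsSparse (S \ T) ε)
    (hQ : IsProdMultiplier S Q) (hg : IntegrableOn g (Ioo 0 1)) {r s G W η : ℝ} (hr0 : 0 ≤ r)
    (hr1 : r < 1) (hs : 0 < s) (hs1 : s ≤ 1 / 4) (hrs : 100 * (1 - r) ≤ ‖1 - r * circlePt s‖)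
    (hG : 1 ≤ G) (hW : 1 ≤ W) (hη : 0 < η) (hηW : η ≤ W) (hgG : ∫ t in Ioo (0 : ℝ) 1, ‖g t‖ ≤ G)
    (hgη : ∫ t in Ioo 0 (2 * s), ‖g t‖ ≤ G * η ^ 4)
    (hout : ∀ v : ℂ, 1 + ‖1 - r * circlePt s‖ / 25 ≤ ‖v‖ →
      ‖multTransform Q g (Ioo 0 1) v‖ ≤ η ^ 4)
    (hne : multTransform Q g (Ioo 0 1) (pushMap (S \ T) ε (r * circlePt s)) ≠ 0) :
    Real.log ‖multTransform Q g (Ioo 0 1) (pushMap (S \ T) ε (r * circlePt s))‖ ≤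
      logMajorant (S \ T) T.card ε (20 * G * W ^ 3) ‖1 - r * circlePt s‖ + Real.log η := by
  have hε := hST.eps_pos
  have hρ : 0 < ‖1 - r * circlePt s‖ :=
    norm_one_sub_pos (by rwa [norm_ofReal_mul_circlePt hr0])
  rw [logMajorant_eq_log hε (by positivity) hρ, ← Real.log_mul (by positivity) hη.ne']
  exact Real.log_le_log (norm_pos_iff.2 hne)
    (hST.norm_multTransform_pushMap_le_of_small hQ hg hr0 hr1 hs hs1 hrs hG hW hη.le hηW hgG hgη
      hout)

theorem IsSparse.log_norm_integral_le (hST : IsSparse (S \ T) ε) (hQ : IsProdMultiplier S Q)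
    (hg : IntegrableOn g (Ioo 0 1)) (h0 : ∫ t in Ioo (0 : ℝ) 1, g t ≠ 0) (ha : 1 ≤ a) {r : ℝ}
    (hr0 : 0 < r) (hr1 : r < 1) {L : ℝ → ℝ} (hL : IntervalIntegrable L volume 0 1)
    (hle : ∀ t ∈ Ioo (0 : ℝ) 1,
      multTransform Q g (Ioo 0 1) (pushMap (S \ T) ε (r * circlePt t)) ≠ 0 →
      Real.log ‖multTransform Q g (Ioo 0 1) (pushMap (S \ T) ε (r * circlePt t))‖ ≤
        logMajorant (S \ T) T.card ε a ‖1 - r * circlePt t‖ + L t) :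
    Real.log ‖∫ t in Ioo (0 : ℝ) 1, g t‖ ≤
      2 * (∫ t in (0 : ℝ)..1, logMajorant (S \ T) T.card ε a t) + ∫ t in (0 : ℝ)..1, L t := by
  set M := logMajorant (S \ T) T.card ε a
  have hM : IntervalIntegrable M volume 0 1 :=
    intervalIntegrable_logMajorant hST.one_le hST.eps_pos (zero_lt_one.trans_le ha)
  have hM' : IntervalIntegrable (fun t => M (1 - t)) volume 0 1 := by
    simpa using (hM.comp_sub_left 1).symm
  have hcenter : multTransform Q g (Ioo 0 1) (pushMap (S \ T) ε 0) = ∫ t in Ioo (0 : ℝ) 1, g t := by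
    rw [pushMap_zero, multTransform_zero_right, hQ.multiplier_eq]
    simp
  have hanalytic : AnalyticOnNhd ℂ (fun z => multTransform Q g (Ioo 0 1) (pushMap (S \ T) ε z))
      (Metric.closedBall 0 |r|) :=
    ((hST.differentiableOn_multTransform_pushMap Q measurableSet_Ioo hg).analyticOnNhd
      Metric.isOpen_ball).mono (Metric.closedBall_subset_ball (by rwa [abs_of_pos hr0]))
  have hjensen := log_norm_le_integral_of_le hr0.ne' hanalytic (by rwa [hcenter])
    (V := fun t => M t + M (1 - t) + L t) ((hM.add hM').add hL) fun t ht hne =>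
      (hle t ht hne).trans (add_le_add_left (logMajorant_le_add hST.one_le hST.eps_pos
        hST.eps_le_one ha ht (min_le_norm_one_sub (Ioo_subset_Icc_self ht) hr0.le hr1.le)) _)
  rwa [hcenter, intervalIntegral.integral_add (hM.add hM') hL, intervalIntegral.integral_add hM hM',
    intervalIntegral.integral_comp_sub_left M, sub_self, sub_zero, ← two_mul] at hjensen

theorem intervalIntegral_indicator_Ioo {f : ℝ → ℝ} {a b c d : ℝ} (hac : a ≤ c) (hcd : c ≤ d)
    (hdb : d ≤ b) : ∫ t in a..b, (Ioo c d).indicator f t = ∫ t in c..d, f t := by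
  rw [intervalIntegral.integral_of_le (hac.trans (hcd.trans hdb)),
    setIntegral_indicator measurableSet_Ioo, intervalIntegral.integral_of_le hcd,
    inter_eq_right.2 (Ioo_subset_Ioc_self.trans (Ioc_subset_Ioc hac hdb)),
    integral_Ioc_eq_integral_Ioo]

theorem IsDeepZeroWeight.integrableOn_log_two_mul {η : ℝ → ℝ} (hη : IsDeepZeroWeight η) {τ : ℝ}
    (hτ : 0 < τ) : IntegrableOn (fun t => Real.log (η (2 * t))) (Icc τ (1 / 4)) := by
  have htwo : ∀ t ∈ Icc τ (1 / 4), 2 * t ∈ Ioo (0 : ℝ) 1 := fun t ht =>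
    ⟨by linarith [ht.1], by linarith [ht.2]⟩
  exact (hη.monotoneOn_log.comp (fun _ _ _ _ h => mul_le_mul_of_nonneg_left h two_pos.le)
    htwo).integrableOn_isCompact isCompact_Icc

theorem IsSparse.log_norm_integral_le_add (hST : IsSparse (S \ T) ε) (hQ : IsProdMultiplier S Q)
    (hg : IntegrableOn g (Ioo 0 1)) (h0 : ∫ t in Ioo (0 : ℝ) 1, g t ≠ 0) {η : ℝ → ℝ}
    (hη : IsDeepZeroWeight η) {G W τ : ℝ} (hG : 1 ≤ G) (hW : 1 ≤ W)
    (hηW : ∀ t ∈ Ioo (0 : ℝ) 1, η t ≤ W) (hgG : ∫ t in Ioo (0 : ℝ) 1, ‖g t‖ ≤ G)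
    (hgη : ∀ s ∈ Ioo (0 : ℝ) 1, ∫ t in Ioo 0 s, ‖g t‖ ≤ G * η s ^ 4) (hτ : τ ∈ Ioo (0 : ℝ) (1 / 4))
    (hout : ∀ v : ℂ, 1 + τ / 25 ≤ ‖v‖ → ‖multTransform Q g (Ioo 0 1) v‖ ≤ η (2 * τ) ^ 4) :
    Real.log ‖∫ t in Ioo (0 : ℝ) 1, g t‖ ≤
      2 * (∫ t in (0 : ℝ)..1, logMajorant (S \ T) T.card ε (20 * G * W ^ 3) t) +
        ∫ t in τ..(1 / 4), Real.log (η (2 * t)) := by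
  obtain ⟨hτ0, hτ1⟩ := hτ
  have hGW : G ≤ G * W ^ 3 := le_mul_of_one_le_right (by linarith) (one_le_pow₀ hW)
  have hint := (hη.integrableOn_log_two_mul hτ0).mono_set (Ioo_subset_Icc_self (b := 1 / 4))
  rw [← intervalIntegral_indicator_Ioo hτ0.le hτ1.le (by norm_num : (1 / 4 : ℝ) ≤ 1)]
  refine hST.log_norm_integral_le hQ hg h0 (r := 1 - τ / 100) (by linarith) (by linarith)
    (by linarith) (hint.integrable_indicator measurableSet_Ioo).intervalIntegrable
    fun t ht hne => ?_
  set r := 1 - τ / 100 with hr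
  have hr0 : 0 ≤ r := by linarith
  have hz : ‖(r : ℂ) * circlePt t‖ < 1 := by
    rw [norm_ofReal_mul_circlePt hr0]
    linarith
  by_cases hts : t ∈ Ioo τ (1 / 4)
  · have ht2 : 2 * t ∈ Ioo (0 : ℝ) 1 := ⟨by linarith [hts.1], by linarith [hts.2]⟩
    have hτ2 : 2 * τ ∈ Ioo (0 : ℝ) 1 := ⟨by linarith, by linarith⟩
    have hτρ : τ ≤ ‖1 - r * circlePt t‖ := (le_min hts.1.le (by linarith [hts.2])).trans
      (min_le_norm_one_sub (Ioo_subset_Icc_self ht) hr0 (by linarith))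
    rw [indicator_of_mem hts]
    refine hST.log_norm_multTransform_pushMap_le_of_small hQ hg hr0 (by linarith) ht.1 hts.2.le
      (by linarith) hG hW (hη.pos _ ht2) (hηW _ ht2) hgG (hgη _ ht2) (fun v hv => ?_) hne
    exact (hout v (by linarith)).trans
      (pow_le_pow_left₀ (hη.pos _ hτ2).le (hη.mono hτ2 ht2 (by linarith [hts.1])) 4)
  · rw [indicator_of_notMem hts, add_zero]
    exact hST.log_norm_multTransform_pushMap_le hQ measurableSet_Ioo hg (by linarith)
      (by linarith) hz hne

end

section

variable {Γ : Set ℕ} {g : ℝ → ℂ}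

theorem HasDeepZero.integral_eq_zero (hg : HasDeepZero g) (hΓ : Γ ⊆ Ici 1)
    (hsum : Summable fun γ : Γ => 1 / √((γ : ℕ) : ℝ))
    (hspec : ∀ n ∈ Ici 1 \ Γ, ∫ t in Ioo (0 : ℝ) 1, g t * circlePt t ^ n = 0) :
    ∫ t in Ioo (0 : ℝ) 1, g t = 0 := by
  by_contra h0
  obtain ⟨η, hη, G, hG, hgG, hgη⟩ := hg.exists_fourth_root
  obtain ⟨M, hM⟩ := hη.bdd
  obtain ⟨T, hT⟩ := exists_finset_sum_le hsum (e := 1 / 9600) (by norm_num)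
  set a := 20 * G * max 1 M ^ 3 with ha
  have ha0 : 0 < a := by positivity
  obtain ⟨τ, hτ, hlog⟩ := hη.exists_integral_log_lt (Real.log ‖∫ t in Ioo (0 : ℝ) 1, g t‖ -
    2 * (2 * (1 / 9600) + T.card * (Real.log (24 * (T.card + 1) / (1 / 200)) + 2) +
      (Real.log (a / (1 / 200)) + 2)))
  have hητ : 0 < η (2 * τ) := hη.pos _ ⟨by linarith [hτ.1], by linarith [hτ.2]⟩
  obtain ⟨S, hSΓ, hout⟩ := exists_norm_multTransform_le (T := T)
    (fun S hS => (hT S hS).trans (by norm_num)) hg.integrableOn hspec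
    (div_pos hτ.1 (by norm_num : (0 : ℝ) < 25)) (pow_pos hητ 4)
  have hS : ∀ γ ∈ S, 1 ≤ γ := fun γ hγ => hΓ (hSΓ hγ)
  obtain ⟨Q, hQ₀, hQ⟩ := exists_multiplier_eq_prod S hS
  have hprod : IsProdMultiplier S Q := ⟨hS, hQ₀, hQ⟩
  have hST : IsSparse (S \ T) (1 / 200) :=
    ⟨fun γ hγ => hS γ (Finset.mem_sdiff.1 hγ).1, by norm_num, by linarith [hT S hSΓ]⟩
  have hmajor := hST.log_norm_integral_le_add hprod hg.integrableOn h0 hη hG (le_max_left 1 M)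
    (fun t ht => (hM t ht).trans (le_max_right 1 M)) hgG hgη hτ (hout Q hprod)
  rw [← ha, integral_logMajorant hST.one_le hST.eps_pos ha0] at hmajor
  linarith [hT S hSΓ]

end

/-! ### Vanishing of all Fourier coefficients -/

theorem summable_one_div_sqrt_image_add {Γ : Set ℕ} (hΓ : Γ ⊆ Ici 1)
    (hsum : Summable fun γ : Γ => 1 / √((γ : ℕ) : ℝ)) (n : ℕ) :
    Summable fun γ : ((fun γ : ℕ => γ + n) '' Γ : Set ℕ) => 1 / √((γ : ℕ) : ℝ) := by
  rw [← (Equiv.Set.image (fun γ : ℕ => γ + n) Γ (add_left_injective n)).summable_iff]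
  refine hsum.of_nonneg_of_le (fun _ => one_div_nonneg.2 (Real.sqrt_nonneg _)) fun γ => ?_
  have hγ : (0 : ℝ) < (γ : ℕ) := by exact_mod_cast hΓ γ.2
  rw [Function.comp_apply, Equiv.Set.image_apply]
  gcongr
  exact Nat.le_add_right _ n

section

variable {Γ : Set ℕ} {g : ℝ → ℂ}

theorem HasDeepZero.mul_circlePt_inv_pow (hg : HasDeepZero g) (n : ℕ) :
    HasDeepZero fun t => g t * (circlePt t)⁻¹ ^ n :=
  hg.of_norm_eq (hg.integrableOn.aestronglyMeasurable.mul
    ((continuous_circlePt.inv₀ circlePt_ne_zero).pow n).aestronglyMeasurable) fun t => by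
      rw [norm_mul, norm_pow, norm_inv, norm_circlePt, inv_one, one_pow, mul_one]

theorem HasDeepZero.conj (hg : HasDeepZero g) : HasDeepZero fun t => conj (g t) :=
  hg.of_norm_eq
    (Complex.continuous_conj.comp_aestronglyMeasurable hg.integrableOn.aestronglyMeasurable)
    fun _ => RCLike.norm_conj _

theorem HasDeepZero.integral_mul_inv_pow_eq_zero (hg : HasDeepZero g) (hΓ : Γ ⊆ Ici 1)
    (hsum : Summable fun γ : Γ => 1 / √((γ : ℕ) : ℝ))
    (hspec : ∀ n ∈ Ici 1 \ Γ, ∫ t in Ioo (0 : ℝ) 1, g t * circlePt t ^ n = 0) (n : ℕ) :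
    ∫ t in Ioo (0 : ℝ) 1, g t * (circlePt t)⁻¹ ^ n = 0 := by
  induction n using Nat.strong_induction_on with
  | _ n ih =>
    refine (hg.mul_circlePt_inv_pow n).integral_eq_zero (Γ := (fun γ => γ + n) '' Γ) ?_
      (summable_one_div_sqrt_image_add hΓ hsum n) fun k hk => ?_
    · rintro _ ⟨γ, hγ, rfl⟩
      exact (hΓ hγ).trans (Nat.le_add_right γ n)
    obtain ⟨j, rfl⟩ | ⟨j, rfl⟩ :=
      (le_or_gt k n).imp Nat.exists_eq_add_of_le Nat.exists_eq_add_of_lt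
    · rw [← ih j (by have := mem_Ici.1 hk.1; omega)]
      congr 1 with t
      rw [pow_add, inv_pow, mul_assoc, mul_right_comm,
        inv_mul_cancel₀ (pow_ne_zero _ (circlePt_ne_zero t)), one_mul]
    · rw [← hspec (j + 1) ⟨Nat.le_add_left 1 j, fun hj => hk.2 ⟨j + 1, hj, add_comm (j + 1) n⟩⟩]
      congr 1 with t
      rw [add_assoc, pow_add, inv_pow, mul_assoc,
        inv_mul_cancel_left₀ (pow_ne_zero _ (circlePt_ne_zero t))]

theorem ae_eq_zero_of_forall_integral_eq_zero (hg : MemLp g 2 (volume.restrict (Ioo 0 1)))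
    (hpos : ∀ n : ℕ, ∫ t in Ioo (0 : ℝ) 1, g t * circlePt t ^ n = 0)
    (hneg : ∀ n : ℕ, ∫ t in Ioo (0 : ℝ) 1, g t * (circlePt t)⁻¹ ^ n = 0) :
    g =ᵐ[volume.restrict (Ioo 0 1)] 0 := by
  have hg' : MemLp g 2 (volume.restrict (Ioc 0 1)) := by
    rwa [← Measure.restrict_congr_set Ioo_ae_eq_Ioc]
  have hall : ∀ n : ℤ, ∫ t in Ioo (0 : ℝ) 1, g t * circlePt t ^ n = 0 := by
    intro n
    obtain ⟨k, rfl | rfl⟩ := n.eq_nat_or_neg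
    · simpa using hpos k
    · simpa using hneg k
  have hcoeff : ∀ n : ℤ, fourierCoeffOn zero_lt_one g n = 0 := by
    intro n
    have hfourier : ∀ t : ℝ, fourier (-n) (t : AddCircle ((1 : ℝ) - 0)) • g t =
        g t * circlePt t ^ (-n) := by
      intro t
      rw [fourier_coe_apply, smul_eq_mul, mul_comm, circlePt, ← Complex.exp_int_mul]
      congr 2
      push_cast
      ring
    simp only [fourierCoeffOn_eq_integral, intervalIntegral.integral_of_le zero_le_one,
      integral_Ioc_eq_integral_Ioo, hfourier, hall, smul_zero]
  have hparseval := hasSum_sq_fourierCoeffOn zero_lt_one hg'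
  simp only [hcoeff, norm_zero, ne_eq, OfNat.ofNat_ne_zero, not_false_eq_true, zero_pow, sub_zero,
    inv_one, one_smul] at hparseval
  have hnorm := hparseval.unique hasSum_zero
  rw [intervalIntegral.integral_of_le zero_le_one, integral_Ioc_eq_integral_Ioo,
    integral_eq_zero_iff_of_nonneg (fun t => by positivity)
      ((memLp_two_iff_integrable_sq_norm hg.1).1 hg)] at hnorm
  filter_upwards [hnorm] with t ht
  simpa using ht

/-- The negative frequencies of `g` are the positive ones of `conj g`, to which the shift argument
applies in turn. -/
theorem HasDeepZero.ae_eq_zero (hg : HasDeepZero g) (hg2 : MemLp g 2 (volume.restrict (Ioo 0 1)))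
    (hΓ : Γ ⊆ Ici 1) (hsum : Summable fun γ : Γ => 1 / √((γ : ℕ) : ℝ))
    (hspec : ∀ n ∈ Ici 1 \ Γ, ∫ t in Ioo (0 : ℝ) 1, g t * circlePt t ^ n = 0) :
    g =ᵐ[volume.restrict (Ioo 0 1)] 0 := by
  have hneg := hg.integral_mul_inv_pow_eq_zero hΓ hsum hspec
  have hconj : ∀ t, conj (circlePt t) = (circlePt t)⁻¹ := fun t =>
    (Complex.inv_eq_conj (norm_circlePt t)).symm
  have hnegConj := hg.conj.integral_mul_inv_pow_eq_zero (empty_subset _) Summable.of_finite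
    fun n _ => by
      have h := congrArg conj (hneg n)
      rw [← integral_conj, map_zero] at h
      simpa only [map_mul, map_pow, map_inv₀, hconj, inv_inv] using h
  refine ae_eq_zero_of_forall_integral_eq_zero hg2 (fun n => ?_) hneg
  have h := congrArg conj (hnegConj n)
  rw [← integral_conj, map_zero] at h
  simpa only [map_mul, map_pow, map_inv₀, hconj, inv_inv, Complex.conj_conj] using h

end

/-! ### Duality -/

section

variable {Γ : Set ℕ} {w : ℝ → ℝ}

theorem IsDeepZeroWeight.aemeasurable (hw : IsDeepZeroWeight w) :
    AEMeasurable w (volume.restrict (Ioo 0 1)) :=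
  aemeasurable_restrict_of_monotoneOn measurableSet_Ioo hw.mono

theorem IsDeepZeroWeight.ae_pos (hw : IsDeepZeroWeight w) :
    ∀ᵐ t ∂volume.restrict (Ioo (0 : ℝ) 1), 0 < w t :=
  ae_restrict_of_forall_mem measurableSet_Ioo hw.pos

theorem IsDeepZeroWeight.absolutelyContinuous (hw : IsDeepZeroWeight w) :
    volume.restrict (Ioo 0 1) ≪ weightMeasure w :=
  withDensity_absolutelyContinuous' hw.aemeasurable.ennreal_ofReal
    (hw.ae_pos.mono fun _ ht => (ENNReal.ofReal_pos.2 ht).ne')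

theorem IsDeepZeroWeight.integral_weightMeasure (hw : IsDeepZeroWeight w) (F : ℝ → ℂ) :
    ∫ t, F t ∂weightMeasure w = ∫ t in Ioo (0 : ℝ) 1, w t * F t := by
  refine (integral_withDensity_eq_integral_toReal_smul₀ hw.aemeasurable.ennreal_ofReal
    (.of_forall fun _ => ENNReal.ofReal_lt_top) F).trans (integral_congr_ae ?_)
  filter_upwards [hw.ae_pos] with t ht
  rw [ENNReal.toReal_ofReal ht.le, Complex.real_smul]

theorem IsDeepZeroWeight.memLp_sqrt_mul (hw : IsDeepZeroWeight w) {f : ℝ → ℂ}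
    (hf : MemLp f 2 (weightMeasure w)) :
    MemLp (fun t => (√(w t) : ℂ) * f t) 2 (volume.restrict (Ioo 0 1)) := by
  have hsqrt : AEStronglyMeasurable (fun t => (√(w t) : ℂ)) (volume.restrict (Ioo 0 1)) :=
    Complex.continuous_ofReal.comp_aestronglyMeasurable
      (Real.continuous_sqrt.comp_aestronglyMeasurable hw.aemeasurable.aestronglyMeasurable)
  refine (memLp_two_iff_integrable_sq_norm (hsqrt.mul (hf.1.mono_ac hw.absolutelyContinuous))).2
    (((integrable_withDensity_iff_integrable_smul₀' hw.aemeasurable.ennreal_ofReal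
      (.of_forall fun _ => ENNReal.ofReal_lt_top)).1
        ((memLp_two_iff_integrable_sq_norm hf.1).1 hf)).congr ?_)
  filter_upwards [hw.ae_pos] with t ht
  rw [ENNReal.toReal_ofReal ht.le, smul_eq_mul, Pi.mul_apply, norm_mul, mul_pow, Complex.norm_real,
    Real.norm_of_nonneg (Real.sqrt_nonneg _), Real.sq_sqrt ht.le]

theorem IsDeepZeroWeight.aestronglyMeasurable_mul_conj (hw : IsDeepZeroWeight w) {f : ℝ → ℂ}
    (hf : MemLp f 2 (weightMeasure w)) :
    AEStronglyMeasurable (fun t => (w t : ℂ) * conj (f t)) (volume.restrict (Ioo 0 1)) :=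
  (Complex.continuous_ofReal.comp_aestronglyMeasurable hw.aemeasurable.aestronglyMeasurable).mul
    (Complex.continuous_conj.comp_aestronglyMeasurable (hf.1.mono_ac hw.absolutelyContinuous))

theorem IsDeepZeroWeight.norm_mul_conj (hw : IsDeepZeroWeight w) (f : ℝ → ℂ) :
    ∀ᵐ t ∂volume.restrict (Ioo (0 : ℝ) 1),
      ‖(w t : ℂ) * conj (f t)‖ = √(w t) * ‖(√(w t) : ℂ) * f t‖ := by
  filter_upwards [hw.ae_pos] with t ht
  rw [norm_mul, norm_mul, RCLike.norm_conj, Complex.norm_real, Complex.norm_real,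
    Real.norm_of_nonneg ht.le, Real.norm_of_nonneg (Real.sqrt_nonneg _), ← mul_assoc,
    Real.mul_self_sqrt ht.le]

theorem IsDeepZeroWeight.memLp_mul_conj (hw : IsDeepZeroWeight w) {f : ℝ → ℂ}
    (hf : MemLp f 2 (weightMeasure w)) :
    MemLp (fun t => (w t : ℂ) * conj (f t)) 2 (volume.restrict (Ioo 0 1)) := by
  obtain ⟨M, hM⟩ := hw.sqrt.bdd
  refine (hw.memLp_sqrt_mul hf).of_le_mul (c := M) (hw.aestronglyMeasurable_mul_conj hf) ?_
  filter_upwards [hw.norm_mul_conj f, ae_restrict_mem measurableSet_Ioo] with t ht ht'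
  exact ht.trans_le (mul_le_mul_of_nonneg_right (hM t ht') (norm_nonneg _))

theorem IsDeepZeroWeight.hasDeepZero_mul_conj (hw : IsDeepZeroWeight w) {f : ℝ → ℂ}
    (hf : MemLp f 2 (weightMeasure w)) : HasDeepZero fun t => (w t : ℂ) * conj (f t) := by
  refine hasDeepZero_of_le_mul (hw.aestronglyMeasurable_mul_conj hf) hw.sqrt
    ((hw.memLp_sqrt_mul hf).norm.integrable one_le_two) ?_
  filter_upwards [hw.norm_mul_conj f] with t ht
  rw [norm_norm]
  exact ht.le

theorem expo_eq_circlePt_pow (n : ℕ) (t : ℝ) : expo n t = circlePt t ^ n := by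
  rw [expo, circlePt, ← Complex.exp_nat_mul]
  congr 1
  ring

theorem IsDeepZeroWeight.integral_eq_zero_of_mem_orthogonal (hw : IsDeepZeroWeight w) {S : Set ℕ}
    {f : Lp ℂ 2 (weightMeasure w)} (hf : f ∈ (Submodule.span ℂ (expSystem w S))ᗮ) {n : ℕ}
    (hn : n ∈ S) : ∫ t in Ioo (0 : ℝ) 1, (w t : ℂ) * conj (f t) * circlePt t ^ n = 0 := by
  have hmem : (hw.memLp_expo n).toLp (expo n) ∈ expSystem w S := ⟨n, hn, MemLp.coeFn_toLp _⟩
  calc ∫ t in Ioo (0 : ℝ) 1, (w t : ℂ) * conj (f t) * circlePt t ^ n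
      = ∫ t, expo n t * conj (f t) ∂weightMeasure w := by
        rw [hw.integral_weightMeasure]
        congr 1 with t
        rw [expo_eq_circlePt_pow, mul_right_comm, mul_assoc]
    _ = inner ℂ f ((hw.memLp_expo n).toLp (expo n)) := by
        rw [L2.inner_def]
        refine integral_congr_ae ?_
        filter_upwards [(hw.memLp_expo n).coeFn_toLp] with t ht
        rw [ht, RCLike.inner_apply]
    _ = 0 := (Submodule.mem_orthogonal' _ f).1 hf _ (Submodule.subset_span hmem)

theorem IsDeepZeroWeight.expSystemSpans (hw : IsDeepZeroWeight w) (hΓ : Γ ⊆ Ici 1)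
    (hsum : Summable fun γ : Γ => 1 / √((γ : ℕ) : ℝ)) : ExpSystemSpans w (Ici 1 \ Γ) := by
  refine (Submodule.topologicalClosure_eq_top_iff).2 ((Submodule.eq_bot_iff _).2 fun f hf => ?_)
  have hzero := (hw.hasDeepZero_mul_conj (Lp.memLp f)).ae_eq_zero (hw.memLp_mul_conj (Lp.memLp f))
    hΓ hsum fun n hn => hw.integral_eq_zero_of_mem_orthogonal hf hn
  refine Lp.eq_zero_iff_ae_eq_zero.2 ((withDensity_absolutelyContinuous _ _).ae_le ?_)
  filter_upwards [hzero, hw.ae_pos] with t ht hwt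
  simpa [hwt.ne'] using ht

end

theorem summable_one_div_sqrt_cubes :
    Summable fun γ : {m : ℕ | ∃ k : ℕ, 1 ≤ k ∧ m = k ^ 3} => 1 / √((γ : ℕ) : ℝ) := by
  have hinj : Function.Injective fun k : ℕ => k ^ 3 := Nat.pow_left_injective three_ne_zero
  have himage : {m : ℕ | ∃ k : ℕ, 1 ≤ k ∧ m = k ^ 3} = (fun k : ℕ => k ^ 3) '' Ici 1 := by
    ext m
    simp [eq_comm]
  rw [himage, ← (Equiv.Set.image (fun k : ℕ => k ^ 3) (Ici 1) hinj).summable_iff]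
  have hrpow : Summable fun k : ℕ => 1 / (k : ℝ) ^ (3 / 2 : ℝ) :=
    Real.summable_one_div_nat_rpow.2 (by norm_num)
  refine (hrpow.subtype (Ici 1)).congr fun k => ?_
  simp only [Function.comp_apply, Equiv.Set.image_apply]
  rw [Nat.cast_pow, Real.sqrt_eq_rpow, ← Real.rpow_natCast_mul (Nat.cast_nonneg _)]
  norm_num

theorem theorem1 :
    (∀ Γ : Set ℕ, Γ ⊆ Set.Ici 1 →
      Summable (fun γ : Γ => 1 / Real.sqrt ((γ : ℕ) : ℝ)) →
        ∀ w : ℝ → ℝ, IsDeepZeroWeight w → ExpSystemSpans w (Set.Ici 1 \ Γ)) ∧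
    (∀ w : ℝ → ℝ, IsDeepZeroWeight w →
      ExpSystemSpans w (Set.Ici 1 \ {m : ℕ | ∃ k : ℕ, 1 ≤ k ∧ m = k ^ 3})) := by
  refine ⟨fun Γ hΓ hsum w hw => hw.expSystemSpans hΓ hsum, fun w hw => hw.expSystemSpans ?_
    summable_one_div_sqrt_cubes⟩
  rintro _ ⟨k, hk, rfl⟩
  exact Nat.one_le_pow _ _ hk
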